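/- **Theorem (Loewner evolution in polygons).** Let $\kappa>0$, let $\beta_1,\dots,\beta_n\in\mathbb R$, put $\rho_k=\frac{\kappa}{2}\beta_k$, and let $z_1,\dots,z_n$ be distinct non-zero real numbers. Let $(W,Z^1,\dots,Z^n)$ be a solution, up to a positive lifetime, of $$dW_t=\sqrt\kappa\,dB_t+\sum_{k=1}^n\frac{\rho_k}{W_t-Z_t^k}\,dt,\qquad dZ^k_t=\frac{2}{Z^k_t-W_t}\,dt,\qquad W_0=0,\ Z^k_0=z_k,$$ with $B$ a standard Brownian motion, and let $\sigma$ be the supremum of the times $t$ before the lifetime such that $W_s,Z^1_s,\dots,Z^n_s$ are distinct for all $0\le s\le t$. Let $g_t(z)$ solve $\partial_tg_t(z)=\frac{2}{g_t(z)-W_t}$, $g_0(z)=z$, on the maximal interval $[0,T_z)$, and let $K_t=\{z\in\overline{\mathbb H}:T_z\le t\}$ be the hull of the $\mathrm{SLE}_\kappa(\rho)$. For $t<\sigma$ let $$SC_t(z)=\int_0^z\prod_{k=1}^n(\zeta-Z^k_t)^{-\beta_k}\,d\zeta,\qquad f_t(z)=SC_t(z)-\int_0^t(\partial_sSC_s)(W_s)\,ds,$$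 where the powers are analytic branches in $\mathbb H$ (the same for all $t$), jointly normalised by any fixed constant of modulus one, and $SC_s(W_s)$, $f_t(W_t)$, $f_t'(W_t)$ are boundary values. Let $D_t=f_t(\mathbb H)$. If $f_t$ is injective this is a planar domain (a polygon). In general $D_t$ is the Riemannian domain over the plane given by $f_t:\mathbb H\to\mathbb C$, that is, $\mathbb H$ with the metric $|f_t'(z)|^2|dz|^2$, with the branches of $f_t^{-1}$ as flat coordinates. Boundary points of $D_t$ are prime ends, and are denoted $f_t(x)$, $x\in\mathbb R\cup\{\infty\}$. The corners are the $f_t(Z_t^k)$. The Poisson kernel $k_{D_t}(q,u)$ is the continuous density, with respect to boundary arc length in $u$, of the harmonic measure of $D_t$ seen from $q$. Write $\partial_2k_{D_t}$ for its derivative in $u$ with respect to boundary arc length, in the direction in which $f_t(x)$ moves as $x$ increases. Let $\partial_2H_{D_t,f_t(\infty)}(q,u)$ be the analytic function of $q\in D_t$ whose real part is $\partial_2k_{D_t}(q,u)$ and which tends to $0$ as $q\to f_t(\infty)$. Then almost surely: 1. For all $0\le t<\sigma$, $g_t$ is a conformal map of $\mathbb H\setminus K_t$ onto $\mathbb H$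 with $g_t(z)-z\to0$ as $z\to\infty$. If $f_0$ is injective on $\mathbb H$, then $f_0^{-1}$ is continuous on the open set $D=f_0(\mathbb H)$, and $h_t=f_t\circ g_t\circ f_0^{-1}$ maps $D\setminus f_0(K_t\cap\mathbb H)$ onto $f_t(\mathbb H)$. 2. For all $0\le t<\sigma$, $k_{D_t}$ and $\partial_2H_{D_t,f_t(\infty)}(\cdot,f_t(W_t))$ exist. 3. Let $h_t=f_t\circ g_t\circ f_0^{-1}$, where $f_0^{-1}$ is any continuous branch, with values in $\mathbb H$, of the inverse of $f_0$ on an open set $V\subset\mathbb C$ (for injective $f_0$ one may take $V=D$). For each $z\in V$ there is a function $t\mapsto\ln h_t'(z)$, with value $0$ at $t=0$, which is a logarithm of $h_t'(z)$ and satisfies, for all $0\le t<\sigma$ with $f_0^{-1}(z)\notin K_t$, $$\partial_t\ln h_t'(z)=2\pi i\,|f_t'(W_t)|^2\;\partial_2H_{D_t,f_t(\infty)}\bigl(h_t(z),f_t(W_t)\bigr),$$ where the time derivative is one-sided at $t=0$, and $h_t(z)$ in the argument of $\partial_2H$ stands for the point $g_t(f_0^{-1}(z))$ of the surface $D_t$.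 When the branches are normalised such that $f_t'(W_t)$ is real, $|f_t'(W_t)|^2=f_t'(W_t)^2$. -/

import Mathlib

open Set Filter Topology MeasureTheory ProbabilityTheory
open scoped NNReal ENNReal
open UpperHalfPlane (upperHalfPlaneSet)

noncomputable section

namespace PolygonLoewner

/-! ### The Loewner evolution of the upper half-plane -/

/-- `γ` solves the chordal Loewner equation `∂ₛ γ = 2 / (γ - w)`, `γ 0 = z`, on `[0, t]`. -/
def IsLoewnerSolution (w : ℝ → ℝ) (z : ℂ) (t : ℝ) (γ : ℝ → ℂ) : Prop :=
  γ 0 = z ∧ ∀ s ∈ Icc 0 t, γ s ≠ w s ∧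
    HasDerivWithinAt γ (2 / (γ s - w s)) (Icc 0 t) s

/-- The lifetime `T_z` of the Loewner equation started at `z`. -/
def loewnerLifetime (w : ℝ → ℝ) (z : ℂ) : ℝ≥0∞ :=
  ⨆ (t : ℝ) (_ : 0 ≤ t ∧ ∃ γ, IsLoewnerSolution w z t γ), ENNReal.ofReal t

/-- The hull `K_t`, the set of the points of the closed half-plane with `T_z ≤ t`. -/
def loewnerHull (w : ℝ → ℝ) (t : ℝ) : Set ℂ :=
  {z | 0 ≤ z.im ∧ loewnerLifetime w z ≤ ENNReal.ofReal t}

open Classical in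
/-- The Loewner map `g_t(z)`: the value at time `t` of the solution started at `z`
(and `0` where there is no solution up to time `t`). -/
def loewnerMap (w : ℝ → ℝ) (t : ℝ) (z : ℂ) : ℂ :=
  if h : ∃ γ, IsLoewnerSolution w z t γ then h.choose t else 0

/-! ### SLE(κ, ρ) -/

/-- The path of a process, as a function of a real time (constant on negative times). -/
def path {Ω : Type*} (X : ℝ≥0 → Ω → ℝ) (ω : Ω) : ℝ → ℝ := fun s => X s.toNNReal ω

/-- `(W, Z)` is a solution on the random time interval `[0, τ)` of the system
`dW = √κ dB + ∑ ρ_k / (W - Z^k) dt`, `dZ^k = 2 / (Z^k - W) dt`, with `W_0 = 0`, `Z_0^k = z_k`.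
The noise is additive, so that the system is a pathwise integral equation. -/
structure IsSLEKappaRho {Ω : Type*} {mΩ : MeasurableSpace Ω} (P : Measure Ω)
    (𝓕 : Filtration ℝ≥0 mΩ) {n : ℕ} (κ : ℝ) (ρ z : Fin n → ℝ)
    (B W : ℝ≥0 → Ω → ℝ) (Z : Fin n → ℝ≥0 → Ω → ℝ) (τ : Ω → ℝ≥0∞) : Prop where
  brownian : IsBrownianReal B P
  adapted_B : StronglyAdapted 𝓕 B
  indep_increments : ∀ s t : ℝ≥0, s ≤ t →
    Indep (MeasurableSpace.comap (fun ω => B t ω - B s ω) inferInstance) (𝓕 s) P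
  adapted_W : StronglyAdapted 𝓕 W
  adapted_Z : ∀ k, StronglyAdapted 𝓕 (Z k)
  stopping : IsStoppingTime 𝓕 τ
  lifetime_pos : ∀ᵐ ω ∂P, 0 < τ ω
  init_W : ∀ᵐ ω ∂P, W 0 ω = 0
  init_Z : ∀ᵐ ω ∂P, ∀ k, Z k 0 ω = z k
  cont_W : ∀ᵐ ω ∂P, ContinuousOn (fun t => W t ω) {t | (t : ℝ≥0∞) < τ ω}
  cont_Z : ∀ᵐ ω ∂P, ∀ k, ContinuousOn (fun t => Z k t ω) {t | (t : ℝ≥0∞) < τ ω}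
  ae_ne : ∀ᵐ ω ∂P, ∀ᵐ s : ℝ, 0 ≤ s → ENNReal.ofReal s < τ ω →
    ∀ k, path W ω s ≠ path (Z k) ω s
  integrable : ∀ᵐ ω ∂P, ∀ t : ℝ≥0, (t : ℝ≥0∞) < τ ω → ∀ k,
    IntervalIntegrable (fun s => 1 / (path W ω s - path (Z k) ω s)) volume 0 t
  eq_W : ∀ᵐ ω ∂P, ∀ t : ℝ≥0, (t : ℝ≥0∞) < τ ω →
    W t ω = √κ * B t ω + ∫ s in (0 : ℝ)..t, ∑ k, ρ k / (path W ω s - path (Z k) ω s)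
  eq_Z : ∀ᵐ ω ∂P, ∀ t : ℝ≥0, (t : ℝ≥0∞) < τ ω → ∀ k,
    Z k t ω = z k + ∫ s in (0 : ℝ)..t, 2 / (path (Z k) ω s - path W ω s)

/-- `σ = sup {t : W_s, Z_s^1, …, Z_s^n are all distinct for 0 ≤ s ≤ t}`, for a solution that
lives on `[0, τ)`. -/
def collisionTime {Ω : Type*} {n : ℕ} (W : ℝ≥0 → Ω → ℝ) (Z : Fin n → ℝ≥0 → Ω → ℝ)
    (τ : Ω → ℝ≥0∞) (ω : Ω) : ℝ≥0∞ :=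
  ⨆ (t : ℝ≥0) (_ : (t : ℝ≥0∞) < τ ω ∧ ∀ s ≤ t,
    (∀ k, W s ω ≠ Z k s ω) ∧ Function.Injective (fun k => Z k s ω)), (t : ℝ≥0∞)

/-! ### Schwarz–Christoffel maps -/

/-- The Schwarz–Christoffel integrand `∏ (ζ - x_k)^(-β_k)` on the upper half-plane. Another choice
of the analytic branches of the powers multiplies the principal ones by a constant `c` of
modulus one. -/
def scIntegrand {n : ℕ} (c : ℂ) (β x : Fin n → ℝ) (ζ : ℂ) : ℂ :=
  c * ∏ k, (ζ - x k) ^ (-(β k : ℂ))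

/-- The Schwarz–Christoffel map `SC(z) = ∫_0^z ∏ (ζ - x_k)^(-β_k) dζ`, the integral taken along
the segment from `0` to `z`. -/
def scMap {n : ℕ} (c : ℂ) (β x : Fin n → ℝ) (z : ℂ) : ℂ :=
  z * ∫ s in (0 : ℝ)..1, scIntegrand c β x (s * z)

/-- `f_t(z) = SC_t(z) - ∫_0^t (∂_s SC_s)(w_s) ds`, where `SC_t` is the Schwarz–Christoffel map with
the prevertices `x_k(t)`. -/
def polygonMap {n : ℕ} (c : ℂ) (β : Fin n → ℝ) (w : ℝ → ℝ) (x : Fin n → ℝ → ℝ)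
    (t : ℝ) (z : ℂ) : ℂ :=
  scMap c β (fun k => x k t) z -
    ∫ s in (0 : ℝ)..t, derivWithin (fun r => scMap c β (fun k => x k r) (w s)) (Ici 0) s

/-! ### Riemannian domains over the plane

A holomorphic `f : ℍ → ℂ` without critical points makes `ℍ` a Riemannian domain over the plane,
which is the planar domain `f(ℍ)` when `f` is injective. Its points are written as points of `ℍ`,
and its boundary points (prime ends) as points of `ℝ` and the point `∞`. A notion of the plane
is carried over by the flat charts, which are the branches of `f⁻¹` on open sets of the plane;
`f⁻¹ : f(ℍ) → ℍ` itself is one of them when `f` is injective. -/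

/-- `φ` is a branch of `f⁻¹` on the open set `V` of the plane, with values in the upper
half-plane. -/
def IsFlatChart (f : ℂ → ℂ) (V : Set ℂ) (φ : ℂ → ℂ) : Prop :=
  IsOpen V ∧ ContinuousOn φ V ∧ MapsTo φ V upperHalfPlaneSet ∧ ∀ q ∈ V, f (φ q) = q

/-- `u` is harmonic on the Riemannian domain of `f`. -/
def IsHarmonicOver (f : ℂ → ℂ) (u : ℂ → ℝ) : Prop :=
  ∀ V φ, IsFlatChart f V φ → InnerProductSpace.HarmonicOnNhd (fun q => u (φ q)) V

/-- `F` is analytic on the Riemannian domain of `f`. -/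
def IsAnalyticOver (f : ℂ → ℂ) (F : ℂ → ℂ) : Prop :=
  ∀ V φ, IsFlatChart f V φ → DifferentiableOn ℂ (fun q => F (φ q)) V

/-- The arc length density `|f'(x)|` of the boundary at the boundary point `x`. -/
def boundarySpeed (f : ℂ → ℂ) (x : ℝ) : ℝ :=
  limUnder (𝓝[upperHalfPlaneSet] (x : ℂ)) (fun z => ‖deriv f z‖)

/-- `k z x` is the Poisson kernel of the Riemannian domain of `f` with the set `S` of corners:
the continuous density, with respect to the boundary arc length `|f'(x)| dx`, of the harmonic
measure of the domain seen from `z`. The harmonic measure is the family of probability measures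
on the boundary whose integrals solve the Dirichlet problem for all bounded boundary data that
are continuous away from the corners. -/
structure IsPoissonKernel (f : ℂ → ℂ) (S : Set ℝ) (k : ℂ → ℝ → ℝ) : Prop where
  cont : ∀ z ∈ upperHalfPlaneSet, ContinuousOn (k z) Sᶜ
  nonneg : ∀ z ∈ upperHalfPlaneSet, ∀ x ∉ S, 0 ≤ k z x
  integrable : ∀ z ∈ upperHalfPlaneSet, Integrable (fun x => k z x * boundarySpeed f x)
  mass : ∀ z ∈ upperHalfPlaneSet, ∫ x, k z x * boundarySpeed f x = 1
  harmonic : ∀ φ : ℝ → ℝ, ContinuousOn φ Sᶜ → (∃ C, ∀ x, |φ x| ≤ C) →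
    IsHarmonicOver f (fun z => ∫ x, φ x * (k z x * boundarySpeed f x))
  boundary : ∀ φ : ℝ → ℝ, ContinuousOn φ Sᶜ → (∃ C, ∀ x, |φ x| ≤ C) → ∀ x₀ ∉ S,
    Tendsto (fun z => ∫ x, φ x * (k z x * boundarySpeed f x))
      (𝓝[upperHalfPlaneSet] (x₀ : ℂ)) (𝓝 (φ x₀))

/-- `H` is the complexified derivative `∂₂H_{D, f(∞)}(·, f(x))` of the Poisson kernel `k` of the
Riemannian domain `D` of `f`: the analytic function whose real part is the derivative of `k` in
its second variable with respect to the boundary arc length at the boundary point `x`, and which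
vanishes at the boundary point `f(∞)`. -/
structure IsComplexifiedDeriv (f : ℂ → ℂ) (k : ℂ → ℝ → ℝ) (x : ℝ) (H : ℂ → ℂ) : Prop where
  analytic : IsAnalyticOver f H
  re_eq : ∀ z ∈ upperHalfPlaneSet, HasDerivAt (k z) ((H z).re * boundarySpeed f x) x
  vanish : Tendsto H (cocompact ℂ ⊓ 𝓟 upperHalfPlaneSet) (𝓝 0)

end PolygonLoewner

end

/-!
The system is driven by additive noise, so the statement holds path by path: all that is used of a
path is that `w` is continuous and that the prevertices solve `x_k' = 2 / (x_k - w)` without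
meeting `w`.

*The equation.* The additive constant in `f_t` does not affect `f_t' = c ∏ (z - x_k)^(-β_k)`, so
`h_t' = f_t'(g_t) g_t' / f_0'` has the explicit logarithm (`logDerivPolygonFlow`)
`-∑ β_k (ln (g_t - x_k(t)) - ln (z - x_k(0))) - ∫_0^t 2 / (g_s - w_s)² ds`,
whose time derivative is `-2 / (g - w)² - ∑ 2 β_k / ((w - x_k) (g - w))`. On the other side, the
harmonic measure of the surface `D_t` is that of the half-plane, so its Poisson kernel is
`Im z / (π |z - x|²)` divided by the boundary speed `∏ |x - x_k|^(-β_k)`. Differentiating it in `x`,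
completing it to an analytic function (`domainPoissonDeriv`) and multiplying by `2πi |f_t'(w)|²`
gives the same expression (`hasDerivWithinAt_logDerivPolygonFlow`).

*Uniqueness of the kernel.* The kernel and its complexified derivative are characterised by their
properties, so both have to be shown unique. Bounded harmonic functions on the half-plane with
boundary values `0` off a finite set vanish: this is the maximum principle, made insensitive to the
exceptional points and to `∞` by subtracting small multiples of the real parts of `(i / (z - p))^½`
and `(-i z)^½` (`nonpos_of_re_of_bounded`). Hence the kernel is unique off the corners
(`IsPoissonKernel.eq_domainPoisson`), and an analytic function vanishing at `∞` is determined by its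
real part (`eq_zero_of_re_eq_zero`). Existence is the solution of the Dirichlet problem by the
Poisson integral.

*The Loewner flow.* The difference of two solutions solves a linear equation, so that
`g_t(z) - g_t(z') = (z - z') exp (-∫ 2 / ((g_s(z) - w_s) (g_s(z') - w_s)) ds)`. This gives
uniqueness, injectivity and the spatial derivative. Surjectivity holds because, backwards in time,
the imaginary part increases, so that solutions stay away from the singularity.

*Regularity of `SC_t`.* A prevertex moves away from `0` on its side of the driving function, so `0`
and `w_t` lie in the same interval between prevertices (`IsPrevertexFlow.separated`). The integrand
continues analytically across this interval to a domain that is star-shaped about `0`, on which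
the radial integral is a primitive (`hasDerivAt_radial_primitive`).
-/

namespace PolygonLoewner

/-! ### Linear differential equations on an interval -/

lemma hasDerivWithinAt_integral_Icc {E : Type*} [NormedAddCommGroup E] [NormedSpace ℝ E]
    [CompleteSpace E] {a : ℝ → E} {T : ℝ} (ha : ContinuousOn a (Icc 0 T)) {s : ℝ}
    (hs : s ∈ Icc 0 T) :
    HasDerivWithinAt (fun u => ∫ r in (0 : ℝ)..u, a r) (a s) (Icc 0 T) s := by
  have : Fact (s ∈ Icc 0 T) := ⟨hs⟩
  refine intervalIntegral.integral_hasDerivWithinAt_right ?_ ?_ (ha s hs)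
  · refine (ha.mono ?_).intervalIntegrable
    rw [uIcc_of_le hs.1]
    exact Icc_subset_Icc_right hs.2
  · exact ha.stronglyMeasurableAtFilter_nhdsWithin measurableSet_Icc s

/-- The solution of `u' = a u` is `u(0) exp (∫ a)`. -/
lemma eq_mul_exp_integral {u a : ℝ → ℂ} {T : ℝ} (ha : ContinuousOn a (Icc 0 T))
    (hu : ∀ s ∈ Icc 0 T, HasDerivWithinAt u (a s * u s) (Icc 0 T) s) {t : ℝ} (ht : t ∈ Icc 0 T) :
    u t = u 0 * Complex.exp (∫ s in (0 : ℝ)..t, a s) := by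
  have hv : ∀ s ∈ Icc 0 T,
      HasDerivWithinAt (fun s => u s * Complex.exp (-∫ r in (0 : ℝ)..s, a r)) 0 (Icc 0 T) s := by
    intro s hs
    have h := (hu s hs).mul ((hasDerivWithinAt_integral_Icc ha hs).neg.cexp)
    exact h.congr_deriv (by ring)
  have hc := constant_of_has_deriv_right_zero (a := 0) (b := T)
    (fun s hs => (hv s hs).continuousWithinAt)
    (fun s hs => (hv s ⟨hs.1, hs.2.le⟩).mono_of_mem_nhdsWithin
      (Icc_mem_nhdsGE_of_mem hs)) t ht
  simp only [intervalIntegral.integral_same, neg_zero, Complex.exp_zero, mul_one] at hc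
  rw [← hc, mul_assoc, ← Complex.exp_add, neg_add_cancel, Complex.exp_zero, mul_one]

/-! ### The Loewner flow -/

lemma IsLoewnerSolution.continuousOn {w : ℝ → ℝ} {z : ℂ} {t : ℝ} {γ : ℝ → ℂ}
    (h : IsLoewnerSolution w z t γ) : ContinuousOn γ (Icc 0 t) :=
  fun s hs => (h.2 s hs).2.continuousWithinAt

lemma IsLoewnerSolution.mono {w : ℝ → ℝ} {z : ℂ} {t t' : ℝ} {γ : ℝ → ℂ}
    (h : IsLoewnerSolution w z t γ) (ht : t' ≤ t) : IsLoewnerSolution w z t' γ :=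
  ⟨h.1, fun s hs => ⟨(h.2 s ⟨hs.1, hs.2.trans ht⟩).1,
    (h.2 s ⟨hs.1, hs.2.trans ht⟩).2.mono (Icc_subset_Icc_right ht)⟩⟩

lemma IsLoewnerSolution.continuousOn_sub {w : ℝ → ℝ} {z : ℂ} {t : ℝ} {γ : ℝ → ℂ}
    (h : IsLoewnerSolution w z t γ) (hw : ContinuousOn w (Icc 0 t)) :
    ContinuousOn (fun s => γ s - w s) (Icc 0 t) :=
  h.continuousOn.sub (Complex.continuous_ofReal.comp_continuousOn hw)

lemma IsLoewnerSolution.sub_ne_zero {w : ℝ → ℝ} {z : ℂ} {t : ℝ} {γ : ℝ → ℂ}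
    (h : IsLoewnerSolution w z t γ) {s : ℝ} (hs : s ∈ Icc 0 t) : γ s - w s ≠ 0 :=
  _root_.sub_ne_zero.2 (h.2 s hs).1

/-- The difference of two solutions solves a linear equation; this gives uniqueness, injectivity
and the derivative of the flow. -/
lemma IsLoewnerSolution.sub_eq {w : ℝ → ℝ} {z z' : ℂ} {t : ℝ} {γ γ' : ℝ → ℂ}
    (h : IsLoewnerSolution w z t γ) (h' : IsLoewnerSolution w z' t γ')
    (hw : ContinuousOn w (Icc 0 t)) {s : ℝ} (hs : s ∈ Icc 0 t) :
    γ s - γ' s = (z - z') *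
      Complex.exp (∫ r in (0 : ℝ)..s, -2 / ((γ r - w r) * (γ' r - w r))) := by
  have := eq_mul_exp_integral (u := fun s => γ s - γ' s)
    (a := fun r => -2 / ((γ r - w r) * (γ' r - w r))) (T := t) ?_ ?_ hs
  · simpa [h.1, h'.1] using this
  · exact continuousOn_const.div ((h.continuousOn_sub hw).mul (h'.continuousOn_sub hw))
      fun r hr => mul_ne_zero (h.sub_ne_zero hr) (h'.sub_ne_zero hr)
  · intro r hr
    refine ((h.2 r hr).2.sub (h'.2 r hr).2).congr_deriv ?_
    have h1 := h.sub_ne_zero hr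
    have h2 := h'.sub_ne_zero hr
    field_simp
    ring

lemma IsLoewnerSolution.eqOn {w : ℝ → ℝ} {z : ℂ} {t : ℝ} {γ γ' : ℝ → ℂ}
    (h : IsLoewnerSolution w z t γ) (h' : IsLoewnerSolution w z t γ')
    (hw : ContinuousOn w (Icc 0 t)) : EqOn γ γ' (Icc 0 t) := by
  intro s hs
  have := h.sub_eq h' hw hs
  rw [sub_self, zero_mul] at this
  exact _root_.sub_eq_zero.1 this

lemma IsLoewnerSolution.hasDerivWithinAt_im {w : ℝ → ℝ} {z : ℂ} {t : ℝ} {γ : ℝ → ℂ}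
    (h : IsLoewnerSolution w z t γ) {s : ℝ} (hs : s ∈ Icc 0 t) :
    HasDerivWithinAt (fun s => (γ s).im) (-2 / Complex.normSq (γ s - w s) * (γ s).im)
      (Icc 0 t) s := by
  have := Complex.imCLM.hasFDerivAt.comp_hasDerivWithinAt s (h.2 s hs).2
  refine this.congr_deriv ?_
  simp [Complex.div_im]
  ring

lemma IsLoewnerSolution.im_eq {w : ℝ → ℝ} {z : ℂ} {t : ℝ} {γ : ℝ → ℂ}
    (h : IsLoewnerSolution w z t γ) (hw : ContinuousOn w (Icc 0 t)) {s : ℝ} (hs : s ∈ Icc 0 t) :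
    (γ s).im = z.im * Real.exp (∫ r in (0 : ℝ)..s, -2 / Complex.normSq (γ r - w r)) := by
  have hc : ContinuousOn (fun r => -2 / Complex.normSq (γ r - w r)) (Icc 0 t) :=
    continuousOn_const.div (Complex.continuous_normSq.comp_continuousOn (h.continuousOn_sub hw))
      fun r hr => (Complex.normSq_pos.2 (h.sub_ne_zero hr)).ne'
  have := eq_mul_exp_integral (u := fun s => ((γ s).im : ℂ))
    (a := fun r => ((-2 / Complex.normSq (γ r - w r) : ℝ) : ℂ)) (T := t)
    (Complex.continuous_ofReal.comp_continuousOn hc) ?_ hs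
  · rw [intervalIntegral.integral_ofReal, h.1] at this
    exact_mod_cast this
  · intro r hr
    have := Complex.ofRealCLM.hasFDerivAt.comp_hasDerivWithinAt r (h.hasDerivWithinAt_im hr)
    exact this.congr_deriv (by simp)

lemma IsLoewnerSolution.im_pos {w : ℝ → ℝ} {z : ℂ} {t : ℝ} {γ : ℝ → ℂ}
    (h : IsLoewnerSolution w z t γ) (hw : ContinuousOn w (Icc 0 t)) (hz : 0 < z.im)
    {s : ℝ} (hs : s ∈ Icc 0 t) : 0 < (γ s).im := by
  rw [h.im_eq hw hs]; positivity

lemma im_le_norm_sub_ofReal (y : ℂ) (a : ℝ) : y.im ≤ ‖y - a‖ := by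
  have := Complex.abs_im_le_norm (y - a)
  simp only [Complex.sub_im, Complex.ofReal_im, sub_zero] at this
  exact (le_abs_self _).trans this

/-- The point of the half-plane `Im ≥ δ` nearest to `y`. -/
def truncIm (δ : ℝ) (y : ℂ) : ℂ := ⟨y.re, max y.im δ⟩

lemma norm_truncIm_sub_le (δ : ℝ) (y y' : ℂ) : ‖truncIm δ y - truncIm δ y'‖ ≤ ‖y - y'‖ := by
  have h : |max y.im δ - max y'.im δ| ≤ |y.im - y'.im| := by
    have := abs_max_sub_max_le_max y.im δ y'.im δ
    simpa using this
  rw [Complex.norm_def, Complex.norm_def]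
  apply Real.sqrt_le_sqrt
  simp only [Complex.normSq_apply, truncIm, Complex.sub_re, Complex.sub_im]
  have := sq_le_sq.2 h
  nlinarith

/-- The Loewner equation whose right-hand side is truncated below the height `δ` can be solved
through any point, at any time, on the whole interval, as the truncated field is bounded
and Lipschitz. -/
lemma exists_truncated_solution {w : ℝ → ℝ} {T : ℝ} (hw : ContinuousOn w (Icc 0 T)) {δ : ℝ}
    (hδ : 0 < δ) {t : ℝ} (ht : t ∈ Icc 0 T) (y : ℂ) :
    ∃ γ : ℝ → ℂ, γ t = y ∧ ∀ s ∈ Icc 0 T,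
      HasDerivWithinAt γ (2 / (truncIm δ (γ s) - w s)) (Icc 0 T) s := by
  have him : ∀ y : ℂ, ∀ a : ℝ, δ ≤ ‖truncIm δ y - a‖ := fun y a =>
    (le_max_right _ _).trans (im_le_norm_sub_ofReal (truncIm δ y) a)
  have hne : ∀ y : ℂ, ∀ a : ℝ, truncIm δ y - a ≠ 0 := fun y a =>
    norm_pos_iff.1 (hδ.trans_le (him y a))
  have hT : 0 ≤ T := ht.1.trans ht.2
  let L : ℝ≥0 := ⟨2 / δ, by positivity⟩
  let K : ℝ≥0 := ⟨2 / δ ^ 2, by positivity⟩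
  let A : ℝ≥0 := ⟨2 / δ * T, by positivity⟩
  have hPL : IsPicardLindelof (fun s y => 2 / (truncIm δ y - w s)) (tmin := 0) (tmax := T)
      ⟨t, ht⟩ y A 0 L K := by
    refine ⟨fun s hs => ?_, fun x hx => ?_, fun s hs x hx => ?_, ?_⟩
    · refine LipschitzOnWith.of_dist_le_mul fun x _ x' _ => ?_
      rw [dist_eq_norm, dist_eq_norm]
      have h1 := hne x (w s)
      have h2 := hne x' (w s)
      have : 2 / (truncIm δ x - w s) - 2 / (truncIm δ x' - w s)
          = 2 * (truncIm δ x' - truncIm δ x) / ((truncIm δ x - w s) * (truncIm δ x' - w s)) := by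
        field_simp
        ring
      rw [this, norm_div, norm_mul, norm_mul]
      have h3 := him x (w s)
      have h4 := him x' (w s)
      have h5 := norm_truncIm_sub_le δ x' x
      rw [norm_sub_rev x' x] at h5
      change _ ≤ 2 / δ ^ 2 * ‖x - x'‖
      rw [div_mul_eq_mul_div, Complex.norm_two, sq]
      gcongr
    · exact continuousOn_const.div
        (continuousOn_const.sub (Complex.continuous_ofReal.comp_continuousOn hw))
        fun s _ => hne x (w s)
    · change _ ≤ 2 / δ
      rw [norm_div, Complex.norm_two]
      have h3 := him x (w s)
      gcongr
    · change 2 / δ * max (T - t) (t - 0) ≤ 2 / δ * T - 0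
      rw [sub_zero, sub_zero]
      gcongr
      exact max_le (by linarith [ht.1]) ht.2
  obtain ⟨γ, h0, h⟩ := hPL.exists_eq_forall_mem_Icc_hasDerivWithinAt₀
  exact ⟨γ, h0, h⟩

lemma truncIm_of_le {δ : ℝ} {y : ℂ} (h : δ ≤ y.im) : truncIm δ y = y := by
  apply Complex.ext <;> simp [truncIm, h]

/-- The Loewner equation can be solved backwards from any point of the half-plane, and the solution
can be continued for a short time. -/
lemma exists_solution_through {w : ℝ → ℝ} {T : ℝ} (hw : ContinuousOn w (Icc 0 T))
    {t : ℝ} (ht : t ∈ Ico 0 T) {y : ℂ} (hy : 0 < y.im) :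
    ∃ t' ∈ Ioc t T, ∃ γ, IsLoewnerSolution w (γ 0) t' γ ∧ γ t = y ∧
      ∀ s ∈ Icc 0 t, y.im ≤ (γ s).im := by
  obtain ⟨γ, h0, h⟩ := exists_truncated_solution hw (half_pos hy) (Ico_subset_Icc_self ht) y
  set δ := y.im / 2
  have hδ : 0 < δ := half_pos hy
  have hanti : AntitoneOn (fun s => (γ s).im) (Icc 0 T) := by
    have hd : ∀ s ∈ Icc 0 T, HasDerivWithinAt (fun s => (γ s).im)
        (2 / (truncIm δ (γ s) - w s)).im (Icc 0 T) s := fun s hs =>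
      Complex.imCLM.hasFDerivAt.comp_hasDerivWithinAt s (h s hs)
    refine antitoneOn_of_hasDerivWithinAt_nonpos (convex_Icc 0 T)
      (fun s hs => (hd s hs).continuousWithinAt)
      (fun s hs => (hd s (interior_subset hs)).mono interior_subset) fun s hs => ?_
    have h1 : 0 ≤ (truncIm δ (γ s)).im := hδ.le.trans (le_max_right _ _)
    have h2 := Complex.normSq_nonneg (truncIm δ (γ s) - w s)
    simp only [Complex.div_im, Complex.sub_im, Complex.ofReal_im, sub_zero]
    norm_num
    positivity
  have hcont : ContinuousOn (fun s => (γ s).im) (Icc 0 T) :=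
    Complex.continuous_im.comp_continuousOn fun s hs => (h s hs).continuousWithinAt
  have hev : ∀ᶠ s in 𝓝[Icc t T] t, δ < (γ s).im := by
    have := (hcont t (Ico_subset_Icc_self ht)).mono (Icc_subset_Icc_left ht.1)
    refine this.eventually_const_lt ?_
    simpa only [h0] using half_lt_self hy
  obtain ⟨t', ht', hlt⟩ : ∃ t' ∈ Ioc t T, δ < (γ t').im := by
    have h1 : 𝓝[Ioc t T] t ≤ 𝓝[Icc t T] t := nhdsWithin_mono _ Ioc_subset_Icc_self
    have h2 : (𝓝[Ioc t T] t).NeBot := by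
      rw [nhdsWithin_Ioc_eq_nhdsGT ht.2]; infer_instance
    obtain ⟨s, hs1, hs2⟩ := ((hev.filter_mono h1).and self_mem_nhdsWithin).exists
    exact ⟨s, hs2, hs1⟩
  have ht'0 : 0 ≤ t' := ht.1.trans ht'.1.le
  have hbig : ∀ s ∈ Icc 0 t', δ < (γ s).im := fun s hs =>
    hlt.trans_le (hanti ⟨hs.1, hs.2.trans ht'.2⟩ ⟨ht'0, ht'.2⟩ hs.2)
  refine ⟨t', ht', γ, ⟨rfl, fun s hs => ⟨fun he => ?_, ?_⟩⟩, h0, fun s hs => ?_⟩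
  · have := hbig s hs
    rw [he, Complex.ofReal_im] at this
    linarith
  · have := (h s ⟨hs.1, hs.2.trans ht'.2⟩).mono (Icc_subset_Icc_right ht'.2)
    rwa [truncIm_of_le (hbig s hs).le] at this
  · rw [← h0]
    exact hanti ⟨hs.1, hs.2.trans ht.2.le⟩ (Ico_subset_Icc_self ht) hs.2

lemma loewnerMap_eq {w : ℝ → ℝ} {z : ℂ} {t t' : ℝ} {γ : ℝ → ℂ} (h : IsLoewnerSolution w z t' γ)
    (ht : 0 ≤ t) (htt' : t ≤ t') (hw : ContinuousOn w (Icc 0 t)) : loewnerMap w t z = γ t := by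
  have hex : ∃ γ, IsLoewnerSolution w z t γ := ⟨γ, h.mono htt'⟩
  rw [loewnerMap, dif_pos hex]
  exact hex.choose_spec.eqOn (h.mono htt') hw ⟨ht, le_rfl⟩

lemma mem_diff_loewnerHull_iff {w : ℝ → ℝ} {z : ℂ} {t : ℝ} (ht : 0 ≤ t) :
    z ∈ upperHalfPlaneSet \ loewnerHull w t ↔
      0 < z.im ∧ ∃ t', t < t' ∧ ∃ γ, IsLoewnerSolution w z t' γ := by
  refine and_congr_right fun (hz : 0 < z.im) => ?_
  simp only [loewnerHull, mem_ofPred_eq, hz.le, true_and, not_le, loewnerLifetime, lt_iSup_iff]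
  constructor
  · rintro ⟨t', ⟨-, hγ⟩, hlt⟩
    exact ⟨t', (ENNReal.ofReal_lt_ofReal_iff_of_nonneg ht).1 hlt, hγ⟩
  · rintro ⟨t', hlt, hγ⟩
    exact ⟨t', ⟨ht.trans hlt.le, hγ⟩, (ENNReal.ofReal_lt_ofReal_iff_of_nonneg ht).2 hlt⟩

/-- `g_t` maps the complement of the hull bijectively onto the half-plane: the Loewner equation can
be solved backwards from every point of the half-plane. -/
lemma bijOn_loewnerMap {w : ℝ → ℝ} {T : ℝ} (hw : ContinuousOn w (Icc 0 T)) {t : ℝ}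
    (ht : t ∈ Ico 0 T) :
    BijOn (loewnerMap w t) (upperHalfPlaneSet \ loewnerHull w t) upperHalfPlaneSet := by
  have hwt : ContinuousOn w (Icc 0 t) := hw.mono (Icc_subset_Icc_right ht.2.le)
  have htt : t ∈ Icc 0 t := ⟨ht.1, le_rfl⟩
  refine ⟨fun z hz => ?_, fun z hz z' hz' he => ?_, fun y hy => ?_⟩
  · obtain ⟨him, t', hlt, γ, hγ⟩ := (mem_diff_loewnerHull_iff ht.1).1 hz
    rw [loewnerMap_eq hγ ht.1 hlt.le hwt]
    exact (hγ.mono hlt.le).im_pos hwt him htt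
  · obtain ⟨him, t₁, hlt, γ, hγ⟩ := (mem_diff_loewnerHull_iff ht.1).1 hz
    obtain ⟨him', t₂, hlt', γ', hγ'⟩ := (mem_diff_loewnerHull_iff ht.1).1 hz'
    rw [loewnerMap_eq hγ ht.1 hlt.le hwt, loewnerMap_eq hγ' ht.1 hlt'.le hwt] at he
    have := (hγ.mono hlt.le).sub_eq (hγ'.mono hlt'.le) hwt htt
    rw [he, sub_self] at this
    exact sub_eq_zero.1 ((mul_eq_zero.1 this.symm).resolve_right (Complex.exp_ne_zero _))
  · obtain ⟨t', ht', γ, hγ, hγt, hle⟩ := exists_solution_through hw ht hy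
    refine ⟨γ 0, (mem_diff_loewnerHull_iff ht.1).2 ⟨?_, t', ht'.1, γ, hγ⟩, ?_⟩
    · exact lt_of_lt_of_le hy (hle 0 ⟨le_rfl, ht.1⟩)
    · rw [loewnerMap_eq hγ ht.1 ht'.1.le hwt, hγt]

/-- The inverse of the flow map at a fixed time is holomorphic. Its difference quotients are known
from `IsLoewnerSolution.sub_eq`. -/
lemma hasDerivAt_backward_flow {w : ℝ → ℝ} {t : ℝ} (ht : 0 ≤ t)
    (hw : ContinuousOn w (Icc 0 t)) {Γ : ℂ → ℝ → ℂ}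
    (hΓ : ∀ y : ℂ, 0 < y.im → IsLoewnerSolution w (Γ y 0) t (Γ y) ∧ Γ y t = y ∧
      ∀ s ∈ Icc 0 t, y.im ≤ (Γ y s).im) {y : ℂ} (hy : 0 < y.im) :
    HasDerivAt (fun y => Γ y 0)
      (Complex.exp (-∫ s in (0 : ℝ)..t, -2 / ((Γ y s - w s) * (Γ y s - w s)))) y := by
  set δ := y.im / 2 with hδdef
  have hδ : 0 < δ := half_pos hy
  have htt : t ∈ Icc 0 t := ⟨ht, le_rfl⟩
  have hnear : ∀ᶠ y' in 𝓝 y, δ < y'.im :=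
    Complex.continuous_im.continuousAt.eventually_const_lt (half_lt_self hy)
  have hlow : ∀ y' : ℂ, δ < y'.im → ∀ s ∈ Icc 0 t, δ ≤ ‖Γ y' s - w s‖ := fun y' hy' s hs =>
    hy'.le.trans (((hΓ y' (hδ.trans hy')).2.2 s hs).trans (im_le_norm_sub_ofReal _ _))
  have hbd : ∀ y' : ℂ, δ < y'.im → ∀ s ∈ Icc 0 t,
      ‖-2 / ((Γ y' s - w s) * (Γ y s - w s))‖ ≤ 2 / δ ^ 2 := by
    intro y' hy' s hs
    rw [norm_div, norm_mul, norm_neg, Complex.norm_two, sq]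
    have h1 := hlow y' hy' s hs
    have h2 := hlow y (half_lt_self hy) s hs
    gcongr
  have hexp : ∀ y' : ℂ, δ < y'.im → ∀ s ∈ Icc 0 t,
      ‖∫ r in (0 : ℝ)..s, -2 / ((Γ y' r - w r) * (Γ y r - w r))‖ ≤ 2 / δ ^ 2 * t := by
    intro y' hy' s hs
    refine (intervalIntegral.norm_integral_le_of_norm_le_const (C := 2 / δ ^ 2) ?_).trans ?_
    · intro r hr
      rw [uIoc_of_le hs.1] at hr
      exact hbd y' hy' r ⟨hr.1.le, hr.2.trans hs.2⟩
    · rw [sub_zero, abs_of_nonneg hs.1]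
      have := hs.2
      gcongr
  have hquot : ∀ y' : ℂ, δ < y'.im → Γ y' 0 - Γ y 0 = (y' - y) *
      Complex.exp (-∫ s in (0 : ℝ)..t, -2 / ((Γ y' s - w s) * (Γ y s - w s))) := by
    intro y' hy'
    have := (hΓ y' (hδ.trans hy')).1.sub_eq (hΓ y hy).1 hw htt
    rw [(hΓ y' (hδ.trans hy')).2.1, (hΓ y hy).2.1] at this
    rw [this, mul_assoc, ← Complex.exp_add, add_neg_cancel, Complex.exp_zero, mul_one]
  have hlip : ∀ y' : ℂ, δ < y'.im → ∀ s ∈ Icc 0 t, ‖Γ y' s - Γ y s‖ ≤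
      ‖y' - y‖ * (Real.exp (2 / δ ^ 2 * t) * Real.exp (2 / δ ^ 2 * t)) := by
    intro y' hy' s hs
    rw [(hΓ y' (hδ.trans hy')).1.sub_eq (hΓ y hy).1 hw hs, hquot y' hy', norm_mul, norm_mul,
      mul_assoc]
    gcongr
    · refine (Complex.norm_exp_le_exp_norm _).trans (Real.exp_le_exp.2 ?_)
      rw [norm_neg]
      exact hexp y' hy' t htt
    · exact (Complex.norm_exp_le_exp_norm _).trans (Real.exp_le_exp.2 (hexp y' hy' s hs))
  rw [hasDerivAt_iff_tendsto_slope]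
  have hlim : Tendsto (fun y' => Complex.exp
      (-∫ s in (0 : ℝ)..t, -2 / ((Γ y' s - w s) * (Γ y s - w s)))) (𝓝 y)
      (𝓝 (Complex.exp (-∫ s in (0 : ℝ)..t, -2 / ((Γ y s - w s) * (Γ y s - w s))))) := by
    refine (Complex.continuous_exp.tendsto _).comp (Tendsto.neg ?_)
    refine intervalIntegral.tendsto_integral_filter_of_dominated_convergence
      (fun _ => 2 / δ ^ 2) ?_ ?_ intervalIntegrable_const ?_
    · filter_upwards [hnear] with y' hy'
      refine ContinuousOn.aestronglyMeasurable ?_ measurableSet_uIoc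
      rw [uIoc_of_le ht]
      refine ContinuousOn.mono ?_ Ioc_subset_Icc_self
      exact continuousOn_const.div (((hΓ y' (hδ.trans hy')).1.continuousOn_sub hw).mul
        ((hΓ y hy).1.continuousOn_sub hw)) fun r hr =>
        mul_ne_zero ((hΓ y' (hδ.trans hy')).1.sub_ne_zero hr) ((hΓ y hy).1.sub_ne_zero hr)
    · filter_upwards [hnear] with y' hy'
      refine Eventually.of_forall fun s hs => hbd y' hy' s ?_
      rw [uIoc_of_le ht] at hs
      exact Ioc_subset_Icc_self hs
    · refine Eventually.of_forall fun s hs => ?_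
      rw [uIoc_of_le ht] at hs
      have hs' := Ioc_subset_Icc_self hs
      have hne := (hΓ y hy).1.sub_ne_zero hs'
      have hc : Tendsto (fun y' => Γ y' s) (𝓝 y) (𝓝 (Γ y s)) := by
        rw [tendsto_iff_norm_sub_tendsto_zero]
        refine squeeze_zero' (Eventually.of_forall fun _ => norm_nonneg _)
          (hnear.mono fun y' hy' => hlip y' hy' s hs') ?_
        have : Tendsto (fun y' => ‖y' - y‖) (𝓝 y) (𝓝 0) := tendsto_norm_sub_self y
        simpa using this.mul_const (Real.exp (2 / δ ^ 2 * t) * Real.exp (2 / δ ^ 2 * t))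
      exact tendsto_const_nhds.div ((hc.sub_const _).mul_const _) (mul_ne_zero hne hne)
  refine (hlim.mono_left nhdsWithin_le_nhds).congr' ?_
  filter_upwards [hnear.filter_mono nhdsWithin_le_nhds, self_mem_nhdsWithin] with y' hy' hne
  rw [slope_def_field, hquot y' hy', mul_div_cancel_left₀ _ (sub_ne_zero.2 hne)]

/-- The spatial derivative of the Loewner flow, obtained by inverting
`hasDerivAt_backward_flow`. -/
lemma hasDerivAt_loewnerMap {w : ℝ → ℝ} {T : ℝ} (hw : ContinuousOn w (Icc 0 T)) {t : ℝ}
    (ht : t ∈ Ico 0 T) {z : ℂ} (hz : 0 < z.im) {t' : ℝ} (htt' : t ≤ t') {γ : ℝ → ℂ}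
    (hγ : IsLoewnerSolution w z t' γ) :
    HasDerivAt (loewnerMap w t)
      (Complex.exp (∫ s in (0 : ℝ)..t, -2 / (γ s - w s) ^ 2)) z := by
  have hwt : ContinuousOn w (Icc 0 t) := hw.mono (Icc_subset_Icc_right ht.2.le)
  have htt : t ∈ Icc 0 t := ⟨ht.1, le_rfl⟩
  have hex : ∀ y : ℂ, ∃ γ : ℝ → ℂ, 0 < y.im → IsLoewnerSolution w (γ 0) t γ ∧ γ t = y ∧
      ∀ s ∈ Icc 0 t, y.im ≤ (γ s).im := by
    intro y
    by_cases hy : 0 < y.im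
    · obtain ⟨t', ht', γ, h1, h2, h3⟩ := exists_solution_through hw ht hy
      exact ⟨γ, fun _ => ⟨h1.mono ht'.1.le, h2, h3⟩⟩
    · exact ⟨0, fun h => absurd h hy⟩
  choose Γ hΓ using hex
  have hγ' := hγ.mono htt'
  have hy := hγ'.im_pos hwt hz htt
  set y := γ t
  have hzΓ : Γ y 0 = z := by
    have := (hΓ y hy).1.sub_eq hγ' hwt htt
    rw [(hΓ y hy).2.1, sub_self] at this
    exact sub_eq_zero.1 ((mul_eq_zero.1 this.symm).resolve_right (Complex.exp_ne_zero _))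
  have heq : EqOn (Γ y) γ (Icc 0 t) := by
    have := (hΓ y hy).1
    rw [hzΓ] at this
    exact this.eqOn hγ' hwt
  have hd := fun y hy => hasDerivAt_backward_flow ht.1 hwt hΓ (y := y) hy
  have han : AnalyticAt ℂ (fun y => Γ y 0) y :=
    DifferentiableOn.analyticAt (s := upperHalfPlaneSet)
      (fun y hy => (hd y hy).differentiableAt.differentiableWithinAt)
      (UpperHalfPlane.isOpen_upperHalfPlaneSet.mem_nhds hy)
  have hs := han.hasStrictDerivAt
  rw [(hd y hy).deriv] at hs
  have hinv := hs.to_local_left_inverse (g := loewnerMap w t) (Complex.exp_ne_zero _) (by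
    filter_upwards [UpperHalfPlane.isOpen_upperHalfPlaneSet.mem_nhds hy] with y' hy'
    rw [loewnerMap_eq (hΓ y' hy').1 ht.1 le_rfl hwt, (hΓ y' hy').2.1])
  rw [hzΓ] at hinv
  refine hinv.hasDerivAt.congr_deriv ?_
  rw [← Complex.exp_neg, neg_neg]
  congr 1
  refine intervalIntegral.integral_congr fun s hs => ?_
  rw [uIcc_of_le ht.1] at hs
  simp only [heq hs, sq]

/-- The flow moves points far away by little. -/
lemma tendsto_loewnerMap_sub_self {w : ℝ → ℝ} {T : ℝ} (hw : ContinuousOn w (Icc 0 T)) {t : ℝ}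
    (ht : t ∈ Ico 0 T) :
    Tendsto (fun ζ => loewnerMap w t ζ - ζ)
      (cocompact ℂ ⊓ 𝓟 (upperHalfPlaneSet \ loewnerHull w t)) (𝓝 0) := by
  have hwt : ContinuousOn w (Icc 0 t) := hw.mono (Icc_subset_Icc_right ht.2.le)
  obtain ⟨M, hM⟩ := isCompact_Icc.exists_bound_of_continuousOn hwt
  have hM0 : 0 ≤ M := (norm_nonneg _).trans (hM 0 ⟨le_rfl, ht.1⟩)
  -- As long as `γ` is within distance `1` of `ζ`, its speed is at most `2 / (‖ζ‖ - M - 1)`; for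
  -- large `ζ` this confines `γ` to the unit disc about `ζ` up to time `t`.
  have key : ∀ ζ ∈ upperHalfPlaneSet \ loewnerHull w t, M + 2 + 3 * t ≤ ‖ζ‖ →
      ‖loewnerMap w t ζ - ζ‖ ≤ 3 / (‖ζ‖ - M - 1) * t := by
    intro ζ hζ hR
    obtain ⟨him, t', hlt, γ, hγ'⟩ := (mem_diff_loewnerHull_iff ht.1).1 hζ
    have hγ := hγ'.mono hlt.le
    rw [loewnerMap_eq hγ' ht.1 hlt.le hwt]
    have hpos : 0 < ‖ζ‖ - M - 1 := by have := ht.1; linarith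
    refine image_norm_le_of_norm_deriv_right_lt_deriv_boundary (a := 0) (b := t)
      (f := fun s => γ s - ζ) (f' := fun s => 2 / (γ s - w s))
      (B := fun s => 3 / (‖ζ‖ - M - 1) * s) (B' := fun _ => 3 / (‖ζ‖ - M - 1))
      (hγ.continuousOn.sub continuousOn_const) (fun s hs => ?_) ?_ (fun s => ?_) (fun s hs he => ?_)
      ⟨ht.1, le_rfl⟩
    · exact ((hγ.2 s ⟨hs.1, hs.2.le⟩).2.mono_of_mem_nhdsWithin
        (Icc_mem_nhdsGE_of_mem hs)).sub_const ζ
    · simp [hγ.1]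
    · simpa using (hasDerivAt_id s).const_mul (3 / (‖ζ‖ - M - 1))
    · have h1 : ‖γ s - ζ‖ ≤ 1 := by
        rw [he, div_mul_eq_mul_div, div_le_one hpos]
        linarith [hs.2.le]
      have h2 : ‖(w s : ℂ)‖ ≤ M := by
        rw [Complex.norm_real]; exact hM s ⟨hs.1, hs.2.le⟩
      have h3 : ‖ζ‖ - M - 1 ≤ ‖γ s - w s‖ := by
        have h4 : ζ = (γ s - w s) + w s - (γ s - ζ) := by ring
        have h5 : ‖ζ‖ ≤ ‖γ s - w s‖ + ‖(w s : ℂ)‖ + ‖γ s - ζ‖ := by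
          calc ‖ζ‖ = ‖(γ s - w s) + w s - (γ s - ζ)‖ := by rw [← h4]
            _ ≤ _ := (norm_sub_le _ _).trans (by gcongr; exact norm_add_le _ _)
        linarith
      rw [norm_div, Complex.norm_two]
      calc 2 / ‖γ s - w s‖ ≤ 2 / (‖ζ‖ - M - 1) := by gcongr
        _ < 3 / (‖ζ‖ - M - 1) := by gcongr; norm_num
  have hnorm : Tendsto (fun ζ : ℂ => ‖ζ‖)
      (cocompact ℂ ⊓ 𝓟 (upperHalfPlaneSet \ loewnerHull w t)) atTop :=
    (tendsto_norm_cocompact_atTop (E := ℂ)).mono_left inf_le_left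
  refine squeeze_zero_norm' (a := fun ζ => 3 / (‖ζ‖ - M - 1) * t) ?_ ?_
  · filter_upwards [hnorm.eventually_ge_atTop (M + 2 + 3 * t),
      (mem_inf_of_right (mem_principal_self _))] with ζ h1 h2
    exact key ζ h2 h1
  · have h1 : Tendsto (fun ζ : ℂ => ‖ζ‖ - M - 1)
        (cocompact ℂ ⊓ 𝓟 (upperHalfPlaneSet \ loewnerHull w t)) atTop := by
      simpa only [sub_eq_add_neg] using
        (tendsto_atTop_add_const_right _ (-1) (tendsto_atTop_add_const_right _ (-M) hnorm))
    simpa using (tendsto_const_nhds.div_atTop h1).mul_const t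

/-! ### Schwarz–Christoffel maps: derivatives -/

/-- The radial integral is a primitive of a holomorphic function on an open set that is star-shaped
about `0`. -/
lemma hasDerivAt_radial_primitive {U : Set ℂ} (hU : IsOpen U)
    (hstar : ∀ z ∈ U, ∀ s ∈ Icc (0 : ℝ) 1, (s : ℂ) * z ∈ U) {Φ : ℂ → ℂ}
    (hΦ : DifferentiableOn ℂ Φ U) {z : ℂ} (hz : z ∈ U) :
    HasDerivAt (fun z => z * ∫ s in (0 : ℝ)..1, Φ (s * z)) (Φ z) z := by
  have hd : ∀ ζ ∈ U, HasDerivAt Φ (deriv Φ ζ) ζ := fun ζ hζ =>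
    (hΦ.differentiableAt (hU.mem_nhds hζ)).hasDerivAt
  have hd' : ContinuousOn (deriv Φ) U := (hΦ.deriv hU).continuousOn
  obtain ⟨ε, hε, hball⟩ := Metric.nhds_basis_closedBall.mem_iff.1 (hU.mem_nhds hz)
  have hsub : (fun p : ℝ × ℂ => (p.1 : ℂ) * p.2) '' (Icc 0 1 ×ˢ Metric.closedBall z ε) ⊆ U := by
    rintro _ ⟨⟨s, y⟩, ⟨hs, hy⟩, rfl⟩
    exact hstar y (hball hy) s hs
  have hcpt : IsCompact
      ((fun p : ℝ × ℂ => (p.1 : ℂ) * p.2) '' (Icc 0 1 ×ˢ Metric.closedBall z ε)) :=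
    (isCompact_Icc.prod (isCompact_closedBall z ε)).image (by fun_prop)
  obtain ⟨C, hC⟩ := hcpt.exists_bound_of_continuousOn (hd'.mono hsub)
  have hIoc : uIoc (0 : ℝ) 1 ⊆ Icc 0 1 := by
    rw [uIoc_of_le zero_le_one]; exact Ioc_subset_Icc_self
  have hray : ∀ y ∈ U, ∀ Ψ : ℂ → ℂ, ContinuousOn Ψ U →
      ContinuousOn (fun s : ℝ => Ψ (s * y)) (Icc 0 1) := fun y hy Ψ hΨ =>
    hΨ.comp (by fun_prop) fun s hs => hstar y hy s hs
  have hcs : ContinuousOn (fun s : ℝ => (s : ℂ) * deriv Φ (s * z)) (Icc 0 1) :=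
    (Complex.continuous_ofReal.continuousOn).mul (hray z hz _ hd')
  obtain ⟨hint, hder⟩ := intervalIntegral.hasDerivAt_integral_of_dominated_loc_of_deriv_le
    (𝕜 := ℂ) (μ := volume) (a := 0) (b := 1) (F := fun y (s : ℝ) => Φ (s * y))
    (F' := fun y (s : ℝ) => (s : ℂ) * deriv Φ (s * y)) (bound := fun _ => C)
    (Metric.closedBall_mem_nhds z hε)
    (by
      filter_upwards [hU.mem_nhds hz] with y hy
      exact ((hray y hy Φ hΦ.continuousOn).mono hIoc).aestronglyMeasurable measurableSet_uIoc)
    ((hray z hz Φ hΦ.continuousOn).intervalIntegrable_of_Icc zero_le_one)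
    ((hcs.mono hIoc).aestronglyMeasurable measurableSet_uIoc)
    (Eventually.of_forall fun s hs y hy => by
      have hs' := hIoc hs
      rw [norm_mul, Complex.norm_real, Real.norm_of_nonneg hs'.1]
      have h1 := hC _ ⟨(s, y), ⟨hs', hy⟩, rfl⟩
      calc s * ‖deriv Φ (s * y)‖ ≤ 1 * ‖deriv Φ (s * y)‖ := by
            have := hs'.2
            gcongr
        _ ≤ C := by simpa using h1)
    intervalIntegrable_const
    (Eventually.of_forall fun s hs y hy => by
      have h1 := (hd _ (hstar y (hball hy) s (hIoc hs))).comp y ((hasDerivAt_id y).const_mul (s : ℂ))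
      exact h1.congr_deriv (by ring))
  have hftc : ∫ s in (0 : ℝ)..1, (Φ (s * z) + z * ((s : ℂ) * deriv Φ (s * z))) = Φ z := by
    have := intervalIntegral.integral_eq_sub_of_hasDeriv_right_of_le (a := 0) (b := 1)
      (f := fun s : ℝ => (s : ℂ) * Φ (s * z))
      (f' := fun s : ℝ => Φ (s * z) + z * ((s : ℂ) * deriv Φ (s * z))) zero_le_one
      (Complex.continuous_ofReal.continuousOn.mul (hray z hz Φ hΦ.continuousOn))
      (fun s hs => by
        have h0 : HasDerivAt (fun s : ℝ => (s : ℂ)) 1 s := Complex.ofRealCLM.hasDerivAt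
        have h1 := (hd _ (hstar z hz s (Ioo_subset_Icc_self hs))).comp s (h0.mul_const z)
        exact ((h0.mul h1).congr_deriv (by
          simp only [Function.comp_apply]
          ring)).hasDerivWithinAt)
      (((hray z hz Φ hΦ.continuousOn).add
        (continuousOn_const.mul hcs)).intervalIntegrable_of_Icc zero_le_one)
    simpa using this
  refine ((hasDerivAt_id z).mul hder).congr_deriv ?_
  rw [← hftc, intervalIntegral.integral_add
    ((hray z hz Φ hΦ.continuousOn).intervalIntegrable_of_Icc zero_le_one)
    (hint.const_mul z), intervalIntegral.integral_const_mul]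
  simp

/-- The plane cut along the rays that go out from the prevertices, away from `0`. -/
def slitDomain {n : ℕ} (x : Fin n → ℝ) : Set ℂ :=
  {ζ | ∀ k, if x k < 0 then ζ - x k ∈ Complex.slitPlane else x k - ζ ∈ Complex.slitPlane}

/-- The continuation of the Schwarz–Christoffel integrand from the upper half-plane
to `slitDomain x`. -/
noncomputable def scBranch {n : ℕ} (c : ℂ) (β x : Fin n → ℝ) (ζ : ℂ) : ℂ :=
  c * ∏ k, if x k < 0 then (ζ - x k) ^ (-(β k : ℂ))
    else Complex.exp (-(β k : ℂ) * (Real.pi * Complex.I)) * (x k - ζ) ^ (-(β k : ℂ))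

lemma isOpen_slitDomain {n : ℕ} (x : Fin n → ℝ) : IsOpen (slitDomain x) := by
  simp only [slitDomain, ofPred_forall]
  refine isOpen_iInter_of_finite fun k => ?_
  split_ifs
  · exact Complex.isOpen_slitPlane.preimage (by fun_prop)
  · exact Complex.isOpen_slitPlane.preimage (by fun_prop)

lemma slitDomain_star {n : ℕ} {x : Fin n → ℝ} (hx : ∀ k, x k ≠ 0) (z : ℂ)
    (hz : z ∈ slitDomain x) (s : ℝ) (hs : s ∈ Icc (0 : ℝ) 1) : (s : ℂ) * z ∈ slitDomain x := by
  intro k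
  have hk := hz k
  have hslit : ∀ (a : ℝ) (ζ : ℂ), 0 < a → a + ζ ∈ Complex.slitPlane →
      a + s * ζ ∈ Complex.slitPlane := by
    intro a ζ ha h
    rw [Complex.mem_slitPlane_iff] at h ⊢
    simp only [Complex.add_re, Complex.add_im, Complex.ofReal_re, Complex.ofReal_im, zero_add,
      Complex.re_ofReal_mul, Complex.im_ofReal_mul] at h ⊢
    rcases h with h | h
    · left
      rcases eq_or_lt_of_le hs.1 with h0 | h0
      · simp [← h0, ha]
      · nlinarith [hs.2]
    · rcases eq_or_lt_of_le hs.1 with h0 | h0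
      · left; simp [← h0, ha]
      · right; exact mul_ne_zero h0.ne' h
  split_ifs at hk ⊢ with h
  · have := hslit (-x k) z (by linarith) (by convert hk using 1; push_cast; ring)
    convert this using 1; push_cast; ring
  · have := hslit (x k) (-z) (lt_of_le_of_ne (not_lt.1 h) (hx k).symm)
      (by convert hk using 1; ring)
    convert this using 1; ring

lemma differentiableOn_scBranch {n : ℕ} (c : ℂ) (β x : Fin n → ℝ) :
    DifferentiableOn ℂ (scBranch c β x) (slitDomain x) := by
  intro ζ hζ
  refine DifferentiableAt.differentiableWithinAt ?_
  unfold scBranch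
  refine DifferentiableAt.const_mul (DifferentiableAt.fun_finsetProd fun k _ => ?_) c
  have hk := hζ k
  split_ifs at hk ⊢
  · exact DifferentiableAt.cpow_const (by fun_prop) hk
  · exact (DifferentiableAt.cpow_const (by fun_prop) hk).const_mul _

lemma scBranch_eq_scIntegrand {n : ℕ} (c : ℂ) (β x : Fin n → ℝ) {ζ : ℂ} (hζ : ζ ∈ slitDomain x)
    (him : 0 ≤ ζ.im) : scBranch c β x ζ = scIntegrand c β x ζ := by
  unfold scBranch scIntegrand
  congr 1
  refine Finset.prod_congr rfl fun k _ => ?_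
  have hk := hζ k
  split_ifs at hk ⊢
  · rfl
  · have hne : (x k : ℂ) - ζ ≠ 0 := Complex.slitPlane_ne_zero hk
    have hne' : ζ - (x k : ℂ) ≠ 0 := by rwa [← neg_sub, neg_ne_zero]
    have harg : (ζ - x k).arg = ((x k : ℂ) - ζ).arg + Real.pi := by
      rw [← neg_sub, Complex.arg_neg_eq_arg_add_pi_iff]
      rw [Complex.mem_slitPlane_iff] at hk
      simp only [Complex.sub_re, Complex.sub_im, Complex.ofReal_re, Complex.ofReal_im,
        zero_sub] at hk ⊢
      rcases eq_or_lt_of_le him with h | h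
      · right
        refine ⟨by simp [← h], hk.resolve_right (by simp [← h])⟩
      · left; linarith
    -- `ζ - x k` is `x k - ζ` turned by the angle `π`, for `ζ` in the closed upper half-plane
    have hlog : Complex.log (ζ - x k) = Complex.log (x k - ζ) + Real.pi * Complex.I := by
      apply Complex.ext
      · simp [Complex.log_re, norm_sub_rev]
      · simp [Complex.log_im, harg]
    rw [Complex.cpow_def_of_ne_zero hne, Complex.cpow_def_of_ne_zero hne', hlog, ← Complex.exp_add]
    congr 1
    ring

lemma upperHalfPlaneSet_subset_slitDomain {n : ℕ} (x : Fin n → ℝ) :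
    upperHalfPlaneSet ⊆ slitDomain x := by
  intro z (hz : 0 < z.im) k
  split_ifs
  · exact Or.inr (by simpa using hz.ne')
  · exact Or.inr (by simpa using hz.ne')

lemma ofReal_mem_slitDomain {n : ℕ} {x : Fin n → ℝ} {p : ℝ}
    (hp : ∀ k, x k < 0 ∧ x k < p ∨ 0 < x k ∧ p < x k) : (p : ℂ) ∈ slitDomain x := by
  intro k
  rcases hp k with ⟨h1, h2⟩ | ⟨h1, h2⟩
  · rw [if_pos h1]
    exact Or.inl (by simpa using h2)
  · rw [if_neg h1.not_gt]
    exact Or.inl (by simpa using h2)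

lemma scMap_eq_radial {n : ℕ} (c : ℂ) (β : Fin n → ℝ) {x : Fin n → ℝ} (hx : ∀ k, x k ≠ 0) {z : ℂ}
    (hz : z ∈ slitDomain x) (him : 0 ≤ z.im) :
    scMap c β x z = z * ∫ s in (0 : ℝ)..1, scBranch c β x (s * z) := by
  unfold scMap
  congr 1
  refine intervalIntegral.integral_congr fun s hs => ?_
  rw [uIcc_of_le zero_le_one] at hs
  refine (scBranch_eq_scIntegrand c β x (slitDomain_star hx z hz s hs) ?_).symm
  rw [Complex.im_ofReal_mul]
  exact mul_nonneg hs.1 him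

/-- `SC' = ∏ (z - x_k)^(-β_k)` on the upper half-plane. -/
lemma hasDerivAt_scMap {n : ℕ} (c : ℂ) (β : Fin n → ℝ) {x : Fin n → ℝ} (hx : ∀ k, x k ≠ 0) {z : ℂ}
    (hz : 0 < z.im) : HasDerivAt (scMap c β x) (scIntegrand c β x z) z := by
  have hmem := upperHalfPlaneSet_subset_slitDomain x hz
  have := hasDerivAt_radial_primitive (isOpen_slitDomain x) (slitDomain_star hx)
    (differentiableOn_scBranch c β x) hmem
  rw [scBranch_eq_scIntegrand c β x hmem hz.le] at this
  refine this.congr_of_eventuallyEq ?_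
  filter_upwards [UpperHalfPlane.isOpen_upperHalfPlaneSet.mem_nhds hz] with y hy
  exact scMap_eq_radial c β hx (upperHalfPlaneSet_subset_slitDomain x hy) (le_of_lt hy)

/-- The boundary derivative of `SC` in the interval between the prevertices that contains `0`. -/
lemma hasDerivAt_scMap_ofReal {n : ℕ} (c : ℂ) (β : Fin n → ℝ) {x : Fin n → ℝ} {p : ℝ}
    (hp : ∀ k, x k < 0 ∧ x k < p ∨ 0 < x k ∧ p < x k) :
    HasDerivAt (fun y : ℝ => scMap c β x y) (scIntegrand c β x p) p := by
  have hx : ∀ k, x k ≠ 0 := fun k => (hp k).elim (fun h => h.1.ne) (fun h => h.1.ne')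
  have hmem := ofReal_mem_slitDomain hp
  have := hasDerivAt_radial_primitive (isOpen_slitDomain x) (slitDomain_star hx)
    (differentiableOn_scBranch c β x) hmem
  rw [scBranch_eq_scIntegrand c β x hmem (by simp)] at this
  refine this.comp_ofReal.congr_of_eventuallyEq ?_
  have hnear := Complex.continuous_ofReal.continuousAt.preimage_mem_nhds
    ((isOpen_slitDomain x).mem_nhds hmem)
  filter_upwards [hnear] with y hy
  exact scMap_eq_radial c β hx hy (by simp)

/-- The modulus of the Schwarz–Christoffel integrand on the real line. -/
noncomputable def scSpeed {n : ℕ} (β x : Fin n → ℝ) (p : ℝ) : ℝ := ∏ k, |p - x k| ^ (-β k)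

lemma norm_scIntegrand {n : ℕ} {c : ℂ} (hc : ‖c‖ = 1) (β x : Fin n → ℝ) (ζ : ℂ) :
    ‖scIntegrand c β x ζ‖ = ∏ k, ‖ζ - x k‖ ^ (-β k) := by
  rw [scIntegrand, norm_mul, hc, one_mul, norm_prod]
  refine Finset.prod_congr rfl fun k _ => ?_
  rw [← Complex.ofReal_neg, Complex.norm_cpow_real]

lemma norm_scIntegrand_ofReal {n : ℕ} {c : ℂ} (hc : ‖c‖ = 1) (β x : Fin n → ℝ) (p : ℝ) :
    ‖scIntegrand c β x p‖ = scSpeed β x p := by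
  rw [norm_scIntegrand hc, scSpeed]
  refine Finset.prod_congr rfl fun k _ => ?_
  rw [← Complex.ofReal_sub, Complex.norm_real, Real.norm_eq_abs]

lemma scIntegrand_ne_zero {n : ℕ} {c : ℂ} (hc : ‖c‖ = 1) (β x : Fin n → ℝ) {ζ : ℂ}
    (hζ : 0 < ζ.im) : scIntegrand c β x ζ ≠ 0 := by
  rw [← norm_pos_iff, norm_scIntegrand hc]
  refine Finset.prod_pos fun k _ => Real.rpow_pos_of_pos ?_ _
  exact hζ.trans_le (im_le_norm_sub_ofReal ζ (x k))

lemma scSpeed_pos {n : ℕ} (β : Fin n → ℝ) {x : Fin n → ℝ} {p : ℝ} (hp : p ∉ range x) :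
    0 < scSpeed β x p :=
  Finset.prod_pos fun k _ => Real.rpow_pos_of_pos
    (abs_pos.2 (sub_ne_zero.2 fun h => hp ⟨k, h.symm⟩)) _

lemma hasDerivAt_scSpeed {n : ℕ} (β : Fin n → ℝ) {x : Fin n → ℝ} {p : ℝ} (hp : p ∉ range x) :
    HasDerivAt (scSpeed β x) (scSpeed β x p * ∑ k, -β k / (p - x k)) p := by
  have hexp : ∀ y ∉ range x, scSpeed β x y = Real.exp (∑ k, Real.log (y - x k) * -β k) := by
    intro y hy
    rw [Real.exp_sum]
    refine Finset.prod_congr rfl fun k _ => ?_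
    rw [Real.rpow_def_of_pos (abs_pos.2 (sub_ne_zero.2 fun h => hy ⟨k, h.symm⟩)), Real.log_abs]
  have hd : HasDerivAt (fun y => Real.exp (∑ k, Real.log (y - x k) * -β k))
      (Real.exp (∑ k, Real.log (p - x k) * -β k) * ∑ k, -β k / (p - x k)) p := by
    refine HasDerivAt.exp (HasDerivAt.fun_sum fun k _ => ?_)
    have hne : p - x k ≠ 0 := sub_ne_zero.2 fun h => hp ⟨k, h.symm⟩
    refine ((((hasDerivAt_id p).sub_const (x k)).log hne).mul_const (-β k)).congr_deriv ?_
    simp only [id]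
    ring
  rw [← hexp p hp] at hd
  refine hd.congr_of_eventuallyEq ?_
  filter_upwards [(finite_range x).isClosed.isOpen_compl.mem_nhds hp] with y hy
  exact hexp y hy

lemma neBot_nhdsWithin_upperHalfPlaneSet (p : ℝ) : (𝓝[upperHalfPlaneSet] (p : ℂ)).NeBot := by
  rw [← mem_closure_iff_nhdsWithin_neBot]
  have : closure {z : ℂ | 0 < z.im} = {z : ℂ | 0 ≤ z.im} := Complex.closure_setOfPred_lt_im 0
  rw [upperHalfPlaneSet, this]
  simp

/-- The maps that agree up to a constant with a Schwarz–Christoffel map have the boundary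
speed `∏ |p - x_k|^(-β_k)`. -/
lemma boundarySpeed_eq {n : ℕ} {c : ℂ} (hc : ‖c‖ = 1) (β : Fin n → ℝ) {x : Fin n → ℝ} {f : ℂ → ℂ}
    (hf : ∀ z : ℂ, 0 < z.im → HasDerivAt f (scIntegrand c β x z) z) {p : ℝ} (hp : p ∉ range x) :
    boundarySpeed f p = scSpeed β x p := by
  have := neBot_nhdsWithin_upperHalfPlaneSet p
  refine Tendsto.limUnder_eq ?_
  have h1 : Tendsto (fun z : ℂ => ∏ k, ‖z - x k‖ ^ (-β k)) (𝓝[upperHalfPlaneSet] (p : ℂ))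
      (𝓝 (∏ k, ‖(p : ℂ) - x k‖ ^ (-β k))) := by
    refine tendsto_finsetProd _ fun k _ => ?_
    have hne : (p : ℂ) - x k ≠ 0 := by
      rw [← Complex.ofReal_sub]
      exact Complex.ofReal_ne_zero.2 (sub_ne_zero.2 fun h => hp ⟨k, h.symm⟩)
    have hcont : ContinuousAt (fun z : ℂ => ‖z - x k‖ ^ (-β k)) (p : ℂ) :=
      ContinuousAt.rpow_const (by fun_prop) (Or.inl (norm_ne_zero_iff.2 hne))
    exact hcont.tendsto.mono_left nhdsWithin_le_nhds
  rw [← norm_scIntegrand hc, norm_scIntegrand_ofReal hc] at h1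
  refine h1.congr' ?_
  filter_upwards [self_mem_nhdsWithin] with z (hz : 0 < z.im)
  rw [(hf z hz).deriv, norm_scIntegrand hc]

lemma hasDerivAt_polygonMap {n : ℕ} (c : ℂ) (β : Fin n → ℝ) (w : ℝ → ℝ) {x : Fin n → ℝ → ℝ}
    {t : ℝ} (hx : ∀ k, x k t ≠ 0) {z : ℂ} (hz : 0 < z.im) :
    HasDerivAt (polygonMap c β w x t) (scIntegrand c β (fun k => x k t) z) z :=
  (hasDerivAt_scMap c β hx hz).sub_const _

lemma hasDerivAt_polygonMap_ofReal {n : ℕ} (c : ℂ) (β : Fin n → ℝ) (w : ℝ → ℝ)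
    {x : Fin n → ℝ → ℝ} {t p : ℝ} (hp : ∀ k, x k t < 0 ∧ x k t < p ∨ 0 < x k t ∧ p < x k t) :
    HasDerivAt (fun y : ℝ => polygonMap c β w x t y) (scIntegrand c β (fun k => x k t) p) p :=
  (hasDerivAt_scMap_ofReal c β hp).sub_const _

/-! ### Flat charts -/

lemma IsFlatChart.hasDerivAt {f f' : ℂ → ℂ} (hf : ∀ z : ℂ, 0 < z.im → HasDerivAt f (f' z) z)
    (hf' : ∀ z : ℂ, 0 < z.im → f' z ≠ 0) {V : Set ℂ} {φ : ℂ → ℂ} (h : IsFlatChart f V φ) {q : ℂ}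
    (hq : q ∈ V) : HasDerivAt φ (f' (φ q))⁻¹ q :=
  HasDerivAt.of_local_left_inverse (h.2.1.continuousAt (h.1.mem_nhds hq))
    (hf _ (h.2.2.1 hq)) (hf' _ (h.2.2.1 hq)) (by
      filter_upwards [h.1.mem_nhds hq] with y hy using h.2.2.2 y hy)

/-- Every point of the half-plane is the value of a flat chart. -/
lemma exists_isFlatChart {f f' : ℂ → ℂ} (hf : ∀ z : ℂ, 0 < z.im → HasDerivAt f (f' z) z)
    (hf' : ∀ z : ℂ, 0 < z.im → f' z ≠ 0) {z : ℂ} (hz : 0 < z.im) :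
    ∃ V φ, IsFlatChart f V φ ∧ f z ∈ V ∧ ∀ᶠ y in 𝓝 z, f y ∈ V ∧ φ (f y) = y := by
  have hopen := UpperHalfPlane.isOpen_upperHalfPlaneSet
  have han : AnalyticAt ℂ f z := DifferentiableOn.analyticAt (s := upperHalfPlaneSet)
    (fun y hy => (hf y hy).differentiableAt.differentiableWithinAt) (hopen.mem_nhds hz)
  have hs := han.hasStrictDerivAt
  rw [(hf z hz).deriv] at hs
  let e := (hs.hasStrictFDerivAt_equiv (hf' z hz)).toOpenPartialHomeomorph f
  have he : ∀ y, e y = f y := fun y => rfl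
  have hze : z ∈ e.source := (hs.hasStrictFDerivAt_equiv (hf' z hz)).mem_toOpenPartialHomeomorph_source
  refine ⟨e.target ∩ e.symm ⁻¹' upperHalfPlaneSet, e.symm,
    ⟨e.isOpen_inter_preimage_symm hopen, e.continuousOn_symm.mono inter_subset_left,
      fun q hq => hq.2, fun q hq => ?_⟩, ⟨e.map_source hze, ?_⟩, ?_⟩
  · rw [← he, e.right_inv hq.1]
  · rw [mem_preimage, ← he, e.left_inv hze]; exact hz
  · filter_upwards [e.open_source.mem_nhds hze, hopen.mem_nhds hz] with y h1 h2
    refine ⟨⟨e.map_source h1, ?_⟩, ?_⟩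
    · rw [mem_preimage, ← he, e.left_inv h1]; exact h2
    · rw [← he, e.left_inv h1]

/-- If `f` is injective, `f⁻¹` is a flat chart on all of `f(ℍ)`. -/
lemma isFlatChart_invFunOn {f f' : ℂ → ℂ} (hf : ∀ z : ℂ, 0 < z.im → HasDerivAt f (f' z) z)
    (hf' : ∀ z : ℂ, 0 < z.im → f' z ≠ 0) (hinj : InjOn f upperHalfPlaneSet) :
    IsFlatChart f (f '' upperHalfPlaneSet) (Function.invFunOn f upperHalfPlaneSet) := by
  have hsub : ∀ V φ, IsFlatChart f V φ → V ⊆ f '' upperHalfPlaneSet ∧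
      EqOn (Function.invFunOn f upperHalfPlaneSet) φ V := by
    intro V φ h
    have h1 : V ⊆ f '' upperHalfPlaneSet := fun q hq => ⟨φ q, h.2.2.1 hq, h.2.2.2 q hq⟩
    refine ⟨h1, fun q hq => hinj (Function.invFunOn_mem (h1 hq)) (h.2.2.1 hq) ?_⟩
    rw [Function.invFunOn_eq (h1 hq), h.2.2.2 q hq]
  refine ⟨isOpen_iff_mem_nhds.2 ?_, ?_, fun q hq => Function.invFunOn_mem hq,
    fun q hq => Function.invFunOn_eq hq⟩
  · rintro _ ⟨z, hz, rfl⟩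
    obtain ⟨V, φ, h, hzV, -⟩ := exists_isFlatChart hf hf' hz
    exact mem_of_superset (h.1.mem_nhds hzV) (hsub V φ h).1
  · rintro _ ⟨z, hz, rfl⟩
    obtain ⟨V, φ, h, hzV, -⟩ := exists_isFlatChart hf hf' hz
    have hφ := (h.2.1.continuousAt (h.1.mem_nhds hzV))
    refine (hφ.congr ?_).continuousWithinAt
    filter_upwards [h.1.mem_nhds hzV] with q hq using ((hsub V φ h).2 hq).symm

/-- An analytic function on the Riemannian domain of `f` is a holomorphic function on the
half-plane. -/
lemma IsAnalyticOver.differentiableAt {f f' : ℂ → ℂ}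
    (hf : ∀ z : ℂ, 0 < z.im → HasDerivAt f (f' z) z) (hf' : ∀ z : ℂ, 0 < z.im → f' z ≠ 0)
    {F : ℂ → ℂ} (hF : IsAnalyticOver f F) {z : ℂ} (hz : 0 < z.im) : DifferentiableAt ℂ F z := by
  obtain ⟨V, φ, h, hzV, hev⟩ := exists_isFlatChart hf hf' hz
  have h1 : DifferentiableAt ℂ (fun q => F (φ q)) (f z) :=
    (hF V φ h).differentiableAt (h.1.mem_nhds hzV)
  refine (h1.comp z (hf z hz).differentiableAt).congr_of_eventuallyEq ?_
  filter_upwards [hev] with y hy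
  simp only [Function.comp_apply, hy.2]

/-- A harmonic function on the Riemannian domain of `f` is, near any point of the half-plane, the
real part of a holomorphic function. -/
lemma IsHarmonicOver.exists_re_eq {f f' : ℂ → ℂ}
    (hf : ∀ z : ℂ, 0 < z.im → HasDerivAt f (f' z) z) (hf' : ∀ z : ℂ, 0 < z.im → f' z ≠ 0)
    {u : ℂ → ℝ} (hu : IsHarmonicOver f u) {z : ℂ} (hz : 0 < z.im) :
    ∃ F : ℂ → ℂ, AnalyticAt ℂ F z ∧ ∀ᶠ y in 𝓝 z, u y = (F y).re := by
  obtain ⟨V, φ, h, hzV, hev⟩ := exists_isFlatChart hf hf' hz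
  obtain ⟨ε, hε, hball⟩ := Metric.isOpen_iff.1 h.1 _ hzV
  obtain ⟨G, hG, hre⟩ := InnerProductSpace.HarmonicOnNhd.exists_analyticOnNhd_ball_re_eq
    (fun q hq => hu V φ h q (hball hq))
  have han : AnalyticAt ℂ f z := DifferentiableOn.analyticAt (s := upperHalfPlaneSet)
    (fun y hy => (hf y hy).differentiableAt.differentiableWithinAt)
    (UpperHalfPlane.isOpen_upperHalfPlaneSet.mem_nhds hz)
  refine ⟨fun y => G (f y), (hG _ (Metric.mem_ball_self hε)).comp han, ?_⟩
  filter_upwards [hev, (hf z hz).continuousAt.preimage_mem_nhds (Metric.ball_mem_nhds _ hε)]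
    with y hy hy'
  have := hre hy'
  simp only [hy.2] at this
  exact this.symm

/-- Real parts of holomorphic functions are harmonic on the Riemannian domain of `f`. -/
lemma isHarmonicOver_of_re {f f' : ℂ → ℂ}
    (hf : ∀ z : ℂ, 0 < z.im → HasDerivAt f (f' z) z) (hf' : ∀ z : ℂ, 0 < z.im → f' z ≠ 0)
    {u : ℂ → ℝ} {F : ℂ → ℂ} (hF : DifferentiableOn ℂ F upperHalfPlaneSet)
    (hu : ∀ z : ℂ, 0 < z.im → u z = (F z).re) : IsHarmonicOver f u := by
  intro V φ h q hq
  have hd : DifferentiableOn ℂ φ V := fun q hq =>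
    (h.hasDerivAt hf hf' hq).differentiableAt.differentiableWithinAt
  refine (InnerProductSpace.harmonicAt_congr_nhds ?_).1
    (AnalyticAt.harmonicAt_re (f := fun q => F (φ q))
      ((hF.comp hd h.2.2.1).analyticAt (h.1.mem_nhds hq)))
  filter_upwards [h.1.mem_nhds hq] with y hy using (hu _ (h.2.2.1 hy)).symm

/-! ### The Poisson kernel of the half-plane -/

/-- The Poisson kernel `Im z / (π |z - x|²)` of the upper half-plane. -/
noncomputable def halfPlanePoisson (z : ℂ) (x : ℝ) : ℝ := z.im / (Real.pi * Complex.normSq (z - x))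

lemma halfPlanePoisson_nonneg {z : ℂ} (hz : 0 < z.im) (x : ℝ) : 0 ≤ halfPlanePoisson z x := by
  have := Complex.normSq_nonneg (z - x)
  unfold halfPlanePoisson
  positivity

lemma ofReal_sub_ne_zero {z : ℂ} (hz : 0 < z.im) (x : ℝ) : (x : ℂ) - z ≠ 0 := by
  intro h
  have := congrArg Complex.im h
  simp only [Complex.sub_im, Complex.ofReal_im, Complex.zero_im] at this
  linarith

lemma sub_ofReal_ne_zero {z : ℂ} (hz : 0 < z.im) (p : ℝ) : z - p ≠ 0 := by
  rw [← neg_sub]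
  exact neg_ne_zero.2 (ofReal_sub_ne_zero hz p)

lemma continuous_halfPlanePoisson {z : ℂ} (hz : 0 < z.im) : Continuous (halfPlanePoisson z) := by
  unfold halfPlanePoisson
  refine continuous_const.div (by fun_prop) fun x => ?_
  refine mul_ne_zero Real.pi_ne_zero (Complex.normSq_pos.2 (sub_ofReal_ne_zero hz x)).ne'

/-- The kernel in the coordinate `s = (x - Re z) / Im z` is the Cauchy density. -/
lemma halfPlanePoisson_affine {z : ℂ} (hz : 0 < z.im) (s : ℝ) :
    halfPlanePoisson z (z.re + z.im * s) = z.im⁻¹ * (Real.pi⁻¹ * (1 + s ^ 2)⁻¹) := by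
  have h1 : Complex.normSq (z - ((z.re + z.im * s : ℝ) : ℂ)) = z.im ^ 2 * (1 + s ^ 2) := by
    rw [Complex.normSq_apply]
    simp only [Complex.sub_re, Complex.sub_im, Complex.ofReal_re, Complex.ofReal_im]
    ring
  rw [halfPlanePoisson, h1]
  have : (1 + s ^ 2) ≠ 0 := by positivity
  field_simp

lemma integrable_halfPlanePoisson {z : ℂ} (hz : 0 < z.im) : Integrable (halfPlanePoisson z) := by
  have h1 : Integrable (fun s : ℝ => halfPlanePoisson z (z.re + z.im * s)) := by
    simp only [halfPlanePoisson_affine hz]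
    exact (integrable_inv_one_add_sq.const_mul _).const_mul _
  have h2 := (integrable_comp_mul_left_iff (fun s => halfPlanePoisson z (z.re + s)) hz.ne').1 h1
  simpa using h2.comp_add_left (-z.re)

/-- The Poisson integral in the coordinate `s = (x - Re z) / Im z`. -/
lemma integral_mul_halfPlanePoisson {z : ℂ} (hz : 0 < z.im) (φ : ℝ → ℝ) :
    ∫ x, φ x * halfPlanePoisson z x =
      ∫ s, φ (z.re + z.im * s) * (Real.pi⁻¹ * (1 + s ^ 2)⁻¹) := by
  have h1 := integral_add_left_eq_self (μ := volume)
    (fun x => φ x * halfPlanePoisson z x) z.re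
  have h2 := Measure.integral_comp_mul_left
    (fun s => φ (z.re + s) * halfPlanePoisson z (z.re + s)) z.im
  rw [← h1]
  simp only [halfPlanePoisson_affine hz] at h2
  have h3 : ∀ s : ℝ, φ (z.re + z.im * s) * (z.im⁻¹ * (Real.pi⁻¹ * (1 + s ^ 2)⁻¹)) =
      z.im⁻¹ * (φ (z.re + z.im * s) * (Real.pi⁻¹ * (1 + s ^ 2)⁻¹)) := fun s => by ring
  simp only [h3] at h2
  rw [integral_const_mul, smul_eq_mul, abs_of_pos (inv_pos.2 hz)] at h2
  exact (mul_left_cancel₀ (inv_pos.2 hz).ne' h2).symm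

lemma integral_halfPlanePoisson {z : ℂ} (hz : 0 < z.im) : ∫ x, halfPlanePoisson z x = 1 := by
  have := integral_mul_halfPlanePoisson hz fun _ => 1
  simp only [one_mul] at this
  rw [this, integral_const_mul, integral_univ_inv_one_add_sq, inv_mul_cancel₀ Real.pi_ne_zero]

/-- The Poisson integral of a bounded function attains the boundary value `φ x₀` wherever `φ` is
continuous. -/
lemma tendsto_poissonIntegral {φ : ℝ → ℝ} (hφ : Measurable φ) {C : ℝ} (hC : ∀ x, |φ x| ≤ C)
    {x₀ : ℝ} (hx₀ : ContinuousAt φ x₀) :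
    Tendsto (fun z => ∫ x, φ x * halfPlanePoisson z x) (𝓝[upperHalfPlaneSet] (x₀ : ℂ))
      (𝓝 (φ x₀)) := by
  have hlim : Tendsto (fun z : ℂ => ∫ s, φ (z.re + z.im * s) * (Real.pi⁻¹ * (1 + s ^ 2)⁻¹))
      (𝓝[upperHalfPlaneSet] (x₀ : ℂ)) (𝓝 (∫ s : ℝ, φ x₀ * (Real.pi⁻¹ * (1 + s ^ 2)⁻¹))) := by
    refine tendsto_integral_filter_of_dominated_convergence
      (fun s => C * (Real.pi⁻¹ * (1 + s ^ 2)⁻¹)) ?_ ?_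
      ((integrable_inv_one_add_sq.const_mul _).const_mul _) ?_
    · exact Eventually.of_forall fun z => Measurable.aestronglyMeasurable (by fun_prop)
    · refine Eventually.of_forall fun z => Eventually.of_forall fun s => ?_
      have h0 : 0 ≤ Real.pi⁻¹ * (1 + s ^ 2)⁻¹ := by positivity
      rw [norm_mul, Real.norm_eq_abs, Real.norm_of_nonneg h0]
      exact mul_le_mul_of_nonneg_right (hC _) h0
    · refine Eventually.of_forall fun s => Tendsto.mul_const _ (hx₀.tendsto.comp ?_)
      have : Continuous fun z : ℂ => z.re + z.im * s := by fun_prop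
      have := (this.tendsto (x₀ : ℂ)).mono_left (nhdsWithin_le_nhds (s := upperHalfPlaneSet))
      simpa using this
  rw [integral_const_mul, integral_const_mul, integral_univ_inv_one_add_sq,
    inv_mul_cancel₀ Real.pi_ne_zero, mul_one] at hlim
  refine hlim.congr' ?_
  filter_upwards [self_mem_nhdsWithin] with z hz
  rw [integral_mul_halfPlanePoisson hz]

lemma norm_inv_sq_eq {z : ℂ} (hz : 0 < z.im) (x : ℝ) :
    (‖(x : ℂ) - z‖⁻¹) ^ 2 = Real.pi / z.im * halfPlanePoisson z x := by
  rw [halfPlanePoisson, Complex.normSq_eq_norm_sq, norm_sub_rev]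
  have h1 := norm_ne_zero_iff.2 (ofReal_sub_ne_zero hz x)
  rw [norm_sub_rev] at h1
  have := Real.pi_ne_zero
  field_simp

/-- The analytic completion of the Poisson kernel in `z`, normalised to vanish at `z = i` so that
it is integrable in `x`. -/
noncomputable def herglotzKernel (z : ℂ) (x : ℝ) : ℂ :=
  (Real.pi * Complex.I)⁻¹ * (((x : ℂ) - z)⁻¹ - ((x : ℂ) - Complex.I)⁻¹)

lemma halfPlanePoisson_eq_re (z : ℂ) (x : ℝ) :
    halfPlanePoisson z x = ((Real.pi * Complex.I)⁻¹ * ((x : ℂ) - z)⁻¹).re := by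
  have h1 : (Real.pi * Complex.I : ℂ)⁻¹ = ((-Real.pi⁻¹ : ℝ) : ℂ) * Complex.I := by
    rw [mul_inv, Complex.inv_I]; push_cast; ring
  rw [h1, mul_assoc, Complex.re_ofReal_mul, Complex.I_mul_re, Complex.inv_im, halfPlanePoisson,
    ← Complex.normSq_neg, neg_sub]
  simp only [Complex.sub_im, Complex.ofReal_im]
  rw [div_mul_eq_div_div]
  ring

lemma herglotzKernel_re (z : ℂ) (x : ℝ) :
    (herglotzKernel z x).re = halfPlanePoisson z x - halfPlanePoisson Complex.I x := by
  rw [halfPlanePoisson_eq_re, halfPlanePoisson_eq_re, herglotzKernel, mul_sub, Complex.sub_re]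

lemma continuous_herglotzKernel {z : ℂ} (hz : 0 < z.im) : Continuous (herglotzKernel z) := by
  unfold herglotzKernel
  refine continuous_const.mul (Continuous.sub ?_ ?_)
  · exact Continuous.inv₀ (by fun_prop) (ofReal_sub_ne_zero hz)
  · exact Continuous.inv₀ (by fun_prop) (ofReal_sub_ne_zero (by simp))

lemma integrable_herglotzKernel {z : ℂ} (hz : 0 < z.im) : Integrable (herglotzKernel z) := by
  have hI : 0 < Complex.I.im := by simp
  have h := ((integrable_halfPlanePoisson hz).const_mul (Real.pi / z.im)).add
    ((integrable_halfPlanePoisson hI).const_mul (Real.pi / Complex.I.im))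
  refine (h.const_mul (Real.pi⁻¹ * ‖z - Complex.I‖)).mono'
    (continuous_herglotzKernel hz).aestronglyMeasurable (Eventually.of_forall fun x => ?_)
  have h1 := ofReal_sub_ne_zero hz x
  have h2 := ofReal_sub_ne_zero hI x
  have h3 : herglotzKernel z x = (Real.pi * Complex.I)⁻¹ * ((z - Complex.I) *
      (((x : ℂ) - z)⁻¹ * ((x : ℂ) - Complex.I)⁻¹)) := by
    rw [herglotzKernel]
    field_simp
    ring
  rw [h3, norm_mul, norm_mul, norm_mul, norm_inv, norm_mul, Complex.norm_I, mul_one,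
    Complex.norm_real, Real.norm_of_nonneg Real.pi_nonneg, norm_inv, norm_inv, ← mul_assoc]
  refine mul_le_mul_of_nonneg_left ?_ (by positivity)
  simp only [Pi.add_apply]
  rw [← norm_inv_sq_eq hz, ← norm_inv_sq_eq hI]
  nlinarith [sq_nonneg (‖(x : ℂ) - z‖⁻¹ - ‖(x : ℂ) - Complex.I‖⁻¹),
    sq_nonneg (‖(x : ℂ) - z‖⁻¹), sq_nonneg (‖(x : ℂ) - Complex.I‖⁻¹)]

/-- The Herglotz integral of a bounded function is holomorphic. -/
lemma differentiableOn_herglotz {φ : ℝ → ℝ} (hφ : Measurable φ) {C : ℝ} (hC : ∀ x, |φ x| ≤ C) :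
    DifferentiableOn ℂ (fun z => ∫ x, (φ x : ℂ) * herglotzKernel z x) upperHalfPlaneSet := by
  intro z₀ (hz₀ : 0 < z₀.im)
  have hC0 : 0 ≤ C := (abs_nonneg _).trans (hC 0)
  have hφm : AEStronglyMeasurable (fun x => (φ x : ℂ)) :=
    (Complex.measurable_ofReal.comp hφ).aestronglyMeasurable
  have hbd : ∀ x, ‖(φ x : ℂ)‖ ≤ C := fun x => by rw [Complex.norm_real]; exact hC x
  have him : ∀ z ∈ Metric.ball z₀ (z₀.im / 2), 0 < z.im := by
    intro z hz
    rw [Metric.mem_ball, dist_eq_norm] at hz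
    have := (Complex.abs_im_le_norm (z - z₀)).trans_lt hz
    rw [Complex.sub_im] at this
    linarith [(abs_lt.1 this).1]
  refine (hasDerivAt_integral_of_dominated_loc_of_deriv_le (𝕜 := ℂ) (μ := volume)
    (F := fun z x => (φ x : ℂ) * herglotzKernel z x)
    (F' := fun z x => (φ x : ℂ) * ((Real.pi * Complex.I)⁻¹ * (((x : ℂ) - z) ^ 2)⁻¹))
    (bound := fun x => C * (Real.pi⁻¹ * (4 * (Real.pi / z₀.im * halfPlanePoisson z₀ x))))
    (Metric.ball_mem_nhds z₀ (half_pos hz₀)) ?_ ?_ ?_ ?_ ?_ ?_).2.differentiableAt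
    |>.differentiableWithinAt
  · filter_upwards [UpperHalfPlane.isOpen_upperHalfPlaneSet.mem_nhds hz₀] with z hz
    exact hφm.mul (continuous_herglotzKernel hz).aestronglyMeasurable
  · exact (integrable_herglotzKernel hz₀).bdd_mul hφm (Eventually.of_forall hbd)
  · refine hφm.mul (Continuous.aestronglyMeasurable ?_)
    refine continuous_const.mul (Continuous.inv₀ (by fun_prop) fun x => ?_)
    exact pow_ne_zero 2 (ofReal_sub_ne_zero hz₀ x)
  · refine Eventually.of_forall fun x z hz => ?_
    rw [norm_mul, norm_mul, norm_inv, norm_inv, norm_mul, Complex.norm_I, mul_one,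
      Complex.norm_real Real.pi, Real.norm_of_nonneg Real.pi_nonneg, ← norm_inv_sq_eq hz₀, norm_pow,
      inv_pow]
    have h1 : 0 < ‖(x : ℂ) - z₀‖ := norm_pos_iff.2 (ofReal_sub_ne_zero hz₀ x)
    have h2 : ‖(x : ℂ) - z₀‖ / 2 ≤ ‖(x : ℂ) - z‖ := by
      have h3 : z₀.im ≤ ‖(x : ℂ) - z₀‖ := by
        rw [norm_sub_rev]; exact im_le_norm_sub_ofReal z₀ x
      rw [Metric.mem_ball, dist_eq_norm] at hz
      have h4 : ‖(x : ℂ) - z₀‖ ≤ ‖(x : ℂ) - z‖ + ‖z - z₀‖ := norm_sub_le_norm_sub_add_norm_sub _ _ _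
      linarith
    have h5 : (‖(x : ℂ) - z‖ ^ 2)⁻¹ ≤ 4 * (‖(x : ℂ) - z₀‖ ^ 2)⁻¹ := by
      calc (‖(x : ℂ) - z‖ ^ 2)⁻¹ ≤ ((‖(x : ℂ) - z₀‖ / 2) ^ 2)⁻¹ := by gcongr
        _ = 4 * (‖(x : ℂ) - z₀‖ ^ 2)⁻¹ := by field_simp; norm_num
    have := hbd x
    have := Real.pi_pos
    gcongr
  · exact ((((integrable_halfPlanePoisson hz₀).const_mul _).const_mul _).const_mul _).const_mul _
  · refine Eventually.of_forall fun x z hz => HasDerivAt.const_mul _ ?_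
    refine HasDerivAt.const_mul _ (HasDerivAt.sub_const _ ?_)
    have h1 := ofReal_sub_ne_zero (him z hz) x
    exact (((hasDerivAt_id z).const_sub (x : ℂ)).inv h1).congr_deriv (by simp)

lemma poissonIntegral_eq_re {φ : ℝ → ℝ} (hφ : Measurable φ) {C : ℝ} (hC : ∀ x, |φ x| ≤ C)
    {z : ℂ} (hz : 0 < z.im) :
    ∫ x, φ x * halfPlanePoisson z x = ((∫ x, (φ x : ℂ) * herglotzKernel z x) +
      (∫ x, φ x * halfPlanePoisson Complex.I x : ℝ)).re := by
  have hI : 0 < Complex.I.im := by simp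
  have hint : ∀ {z : ℂ}, 0 < z.im → Integrable fun x => φ x * halfPlanePoisson z x := fun hz =>
    (integrable_halfPlanePoisson hz).bdd_mul hφ.aestronglyMeasurable (Eventually.of_forall hC)
  have hφm : AEStronglyMeasurable (fun x => (φ x : ℂ)) :=
    (Complex.measurable_ofReal.comp hφ).aestronglyMeasurable
  have hbd : ∀ x, ‖(φ x : ℂ)‖ ≤ C := fun x => by rw [Complex.norm_real]; exact hC x
  have hint' := (integrable_herglotzKernel hz).bdd_mul hφm (Eventually.of_forall hbd)
  have h1 := Complex.reCLM.integral_comp_comm hint'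
  simp only [Complex.reCLM_apply, Complex.re_ofReal_mul, herglotzKernel_re, mul_sub] at h1
  rw [Complex.add_re, Complex.ofReal_re, ← h1, integral_sub (hint hz) (hint hI)]
  ring

lemma abs_poissonIntegral_le {φ : ℝ → ℝ} {C : ℝ} (hC : ∀ x, |φ x| ≤ C) {p : ℝ → ℝ}
    (hp : Integrable p) (hp0 : ∀ᵐ x, 0 ≤ p x) (hp1 : ∫ x, p x = 1) : |∫ x, φ x * p x| ≤ C := by
  have h := norm_integral_le_of_norm_le (hp.const_mul C) (f := fun x => φ x * p x) (by
    filter_upwards [hp0] with x hx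
    rw [norm_mul, Real.norm_of_nonneg hx]
    exact mul_le_mul_of_nonneg_right (hC x) hx)
  rwa [integral_const_mul, hp1, mul_one] at h

/-- A function that is continuous off a finite set is measurable. -/
lemma measurable_of_continuousOn_compl_finite {S : Set ℝ} (hS : S.Finite) {φ : ℝ → ℝ}
    (hφ : ContinuousOn φ Sᶜ) : Measurable φ := by
  classical
  have h : Measurable (Sᶜ.piecewise φ fun _ => 0) :=
    hφ.measurable_piecewise continuousOn_const hS.isClosed.isOpen_compl.measurableSet
  refine h.measurable_of_countable_ne (hS.countable.mono fun x hx => ?_)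
  by_contra hxS
  exact hx (piecewise_eq_of_mem _ _ _ hxS)

/-! ### The maximum principle in the half-plane -/

/-- A function that is locally the real part of a holomorphic function and is asymptotically at
most `0` at the whole boundary, `∞` included, is at most `0`. -/
lemma nonpos_of_re_of_boundary {v : ℂ → ℝ}
    (hv : ∀ z : ℂ, 0 < z.im → ∃ F : ℂ → ℂ, AnalyticAt ℂ F z ∧ ∀ᶠ y in 𝓝 z, v y = (F y).re)
    (hreal : ∀ m > 0, ∀ p : ℝ, ∀ᶠ z in 𝓝[upperHalfPlaneSet] (p : ℂ), v z < m)
    (hinf : ∀ m > 0, ∀ᶠ z in cocompact ℂ ⊓ 𝓟 upperHalfPlaneSet, v z < m)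
    {z : ℂ} (hz : 0 < z.im) : v z ≤ 0 := by
  by_contra! hpos
  have hopen := UpperHalfPlane.isOpen_upperHalfPlaneSet
  have hcont : ∀ z : ℂ, 0 < z.im → ContinuousAt v z := by
    intro z hz
    obtain ⟨F, hF, he⟩ := hv z hz
    exact (Complex.continuous_re.continuousAt.comp hF.continuousAt).congr
      (he.mono fun y hy => hy.symm)
  -- The superlevel sets of positive levels stay away from the boundary.
  have hcomp : ∀ m > 0, IsCompact {z : ℂ | 0 < z.im ∧ m ≤ v z} := by
    intro m hm
    refine Metric.isCompact_of_isClosed_isBounded ?_ ?_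
    · rw [← isOpen_compl_iff, isOpen_iff_mem_nhds]
      intro p hp
      have hp' : 0 < p.im → v p < m := fun h => not_le.1 fun h' => hp ⟨h, h'⟩
      rcases lt_trichotomy p.im 0 with h | h | h
      · filter_upwards [Complex.continuous_im.continuousAt.eventually_lt_const h] with y hy hy'
        exact lt_asymm hy hy'.1
      · have hpr : p = (p.re : ℂ) := Complex.ext rfl (by simp [h])
        have := hreal m hm p.re
        rw [← hpr] at this
        filter_upwards [eventually_nhdsWithin_iff.1 this] with y hy hy'
        exact absurd (hy hy'.1) (not_lt.2 hy'.2)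
      · filter_upwards [(hcont p h).eventually_lt_const (hp' h)] with y hy hy'
        exact absurd hy (not_lt.2 hy'.2)
    · have := eventually_inf_principal.1 (hinf m hm)
      rw [← Metric.cobounded_eq_cocompact] at this
      refine (Metric.isBounded_iff_subset_ball 0).2 ?_
      obtain ⟨r, -, hr⟩ := (Metric.hasBasis_cobounded_compl_closedBall (0 : ℂ)).eventually_iff.1 this
      refine ⟨r + 1, fun y hy => ?_⟩
      by_contra hy'
      refine absurd (hr (x := y) ?_ hy.1) (not_lt.2 hy.2)
      simp only [Metric.mem_ball, not_lt, mem_compl_iff, Metric.mem_closedBall, not_le] at hy' ⊢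
      linarith
  obtain ⟨z₁, hz₁, hmax⟩ := (hcomp (v z) hpos).exists_isMaxOn ⟨z, hz, le_rfl⟩
    fun y hy => (hcont y hy.1).continuousWithinAt
  have hm1 : 0 < v z₁ := hpos.trans_le hz₁.2
  have hglob : ∀ y : ℂ, 0 < y.im → v y ≤ v z₁ := by
    intro y hy
    by_cases h : v z ≤ v y
    · exact hmax ⟨hy, h⟩
    · exact (not_le.1 h).le.trans hz₁.2
  -- The set of maximum points is open and closed in the plane.
  have hclopen : IsClopen {z : ℂ | 0 < z.im ∧ v z₁ ≤ v z} := by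
    refine ⟨(hcomp _ hm1).isClosed, isOpen_iff_mem_nhds.2 fun y hy => ?_⟩
    obtain ⟨F, hF, he⟩ := hv y hy.1
    have hyv : v y = v z₁ := le_antisymm (hglob y hy.1) hy.2
    have hd : ∀ᶠ y' in 𝓝 y, DifferentiableAt ℂ (fun y => Complex.exp (F y)) y' :=
      hF.eventually_analyticAt.mono fun y' h => h.differentiableAt.cexp
    have hloc : IsLocalMax (norm ∘ fun y => Complex.exp (F y)) y := by
      filter_upwards [he, hopen.mem_nhds hy.1] with y' h1 h2
      simp only [Function.comp_apply, Complex.norm_exp]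
      rw [← h1, ← he.self_of_nhds, hyv]
      exact Real.exp_le_exp.2 (hglob y' h2)
    filter_upwards [Complex.eventually_eq_of_isLocalMax_norm hd hloc, he, hopen.mem_nhds hy.1]
      with y' h1 h2 h3
    refine ⟨h3, ?_⟩
    have := congrArg norm h1
    rw [Complex.norm_exp, Complex.norm_exp, ← h2, ← he.self_of_nhds, Real.exp_eq_exp] at this
    rw [this, hyv]
  have huniv := hclopen.eq_univ ⟨z₁, hz₁.1, le_rfl⟩
  have h0 : (0 : ℂ) ∈ {z : ℂ | 0 < z.im ∧ v z₁ ≤ v z} := huniv ▸ mem_univ _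
  simpa using h0.1

lemma half_rpow_le_re_cpow_half {u : ℂ} (hu : 0 < u.re) :
    ‖u‖ ^ (1 / 2 : ℝ) / 2 ≤ (u ^ ((1 / 2 : ℝ) : ℂ)).re := by
  rw [Complex.cpow_ofReal_re, div_eq_mul_one_div]
  refine mul_le_mul_of_nonneg_left ?_ (by positivity)
  have h1 := Complex.abs_arg_le_pi_div_two_iff.2 hu.le
  rw [← Real.cos_abs]
  refine Real.cos_pi_div_three.symm.trans_le ?_
  refine Real.cos_le_cos_of_nonneg_of_le_pi (abs_nonneg _) ?_ ?_
  · linarith [Real.pi_pos]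
  · rw [abs_mul, abs_of_pos (by norm_num : (0 : ℝ) < 1 / 2)]
    linarith [Real.pi_pos]

/-- A holomorphic function on the half-plane whose real part is positive and tends to `∞` at the
points of `S` and at `∞`. The square roots of functions with positive real part have their argument
in `[-π/4, π/4]`, so that the real part tends to `∞` also along tangential approaches. -/
noncomputable def barrier (S : Finset ℝ) (z : ℂ) : ℂ :=
  (-Complex.I * z) ^ ((1 / 2 : ℝ) : ℂ) + ∑ p ∈ S, (Complex.I / (z - p)) ^ ((1 / 2 : ℝ) : ℂ)

lemma re_neg_I_mul {z : ℂ} : (-Complex.I * z).re = z.im := by simp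

lemma re_I_div_pos {z : ℂ} (hz : 0 < z.im) (p : ℝ) : 0 < (Complex.I / (z - p)).re := by
  have h : 0 < Complex.normSq (z - p) := Complex.normSq_pos.2 (sub_ofReal_ne_zero hz p)
  rw [Complex.div_re]
  simp only [Complex.I_re, Complex.I_im, Complex.sub_im, Complex.ofReal_im, sub_zero, zero_mul,
    zero_div, zero_add, one_mul]
  positivity

lemma analyticAt_barrier (S : Finset ℝ) {z : ℂ} (hz : 0 < z.im) : AnalyticAt ℂ (barrier S) z := by
  refine DifferentiableOn.analyticAt (s := upperHalfPlaneSet) (fun y hy => ?_)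
    (UpperHalfPlane.isOpen_upperHalfPlaneSet.mem_nhds hz)
  have hy : 0 < y.im := hy
  refine DifferentiableAt.differentiableWithinAt (DifferentiableAt.add ?_ ?_)
  · refine DifferentiableAt.cpow_const (by fun_prop) (Or.inl ?_)
    rw [re_neg_I_mul]; exact hy
  · refine DifferentiableAt.fun_sum fun p _ => DifferentiableAt.cpow_const ?_ (Or.inl ?_)
    · exact (differentiableAt_const _).div (by fun_prop) (sub_ofReal_ne_zero hy p)
    · exact re_I_div_pos hy p

lemma le_re_barrier_inf (S : Finset ℝ) {z : ℂ} (hz : 0 < z.im) :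
    ‖z‖ ^ (1 / 2 : ℝ) / 2 ≤ (barrier S z).re := by
  have h1 := half_rpow_le_re_cpow_half (u := -Complex.I * z) (by rwa [re_neg_I_mul])
  rw [norm_mul, norm_neg, Complex.norm_I, one_mul] at h1
  rw [barrier, Complex.add_re, Complex.re_sum]
  have h2 : 0 ≤ ∑ p ∈ S, ((Complex.I / (z - p)) ^ ((1 / 2 : ℝ) : ℂ)).re :=
    Finset.sum_nonneg fun p _ =>
      le_trans (by positivity) (half_rpow_le_re_cpow_half (re_I_div_pos hz p))
  linarith

lemma le_re_barrier_point {S : Finset ℝ} {p : ℝ} (hp : p ∈ S) {z : ℂ} (hz : 0 < z.im) :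
    ‖z - p‖⁻¹ ^ (1 / 2 : ℝ) / 2 ≤ (barrier S z).re := by
  have h1 := half_rpow_le_re_cpow_half (u := -Complex.I * z) (by rwa [re_neg_I_mul])
  have h0 : (0 : ℝ) ≤ ‖-Complex.I * z‖ ^ (1 / 2 : ℝ) / 2 := by positivity
  rw [barrier, Complex.add_re, Complex.re_sum]
  have h2 := Finset.single_le_sum
    (f := fun p : ℝ => ((Complex.I / (z - p)) ^ ((1 / 2 : ℝ) : ℂ)).re) (s := S)
    (fun p _ => le_trans (by positivity) (half_rpow_le_re_cpow_half (re_I_div_pos hz p))) hp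
  have h3 := half_rpow_le_re_cpow_half (re_I_div_pos hz p)
  rw [norm_div, Complex.norm_I, one_div ‖z - p‖] at h3
  linarith

/-- The maximum principle for bounded functions with finitely many exceptional boundary points,
besides `∞`. -/
lemma nonpos_of_re_of_bounded {v : ℂ → ℝ} {S : Set ℝ} (hS : S.Finite)
    (hv : ∀ z : ℂ, 0 < z.im → ∃ F : ℂ → ℂ, AnalyticAt ℂ F z ∧ ∀ᶠ y in 𝓝 z, v y = (F y).re)
    {C : ℝ} (hC : ∀ z : ℂ, 0 < z.im → v z ≤ C)
    (hreal : ∀ p ∉ S, Tendsto v (𝓝[upperHalfPlaneSet] (p : ℂ)) (𝓝 0))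
    {z : ℂ} (hz : 0 < z.im) : v z ≤ 0 := by
  lift S to Finset ℝ using hS
  have hb0 : ∀ z : ℂ, 0 < z.im → 0 ≤ (barrier S z).re := fun z hz =>
    le_trans (by positivity) (le_re_barrier_inf S hz)
  -- `v - ε Re (barrier S)` has boundary values at most `0` everywhere; afterwards `ε → 0`.
  have key : ∀ ε > 0, v z ≤ ε * (barrier S z).re := by
    intro ε hε
    have hlarge : ∀ l : Filter ℂ, l ≤ 𝓟 upperHalfPlaneSet →
        Tendsto (fun z => (barrier S z).re) l atTop → ∀ m > 0,
        ∀ᶠ z in l, v z - ε * (barrier S z).re < m := by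
      intro l hl ht m hm
      filter_upwards [ht.eventually_ge_atTop (C / ε), hl (mem_principal_self _)] with y h1 h2
      have h3 := hC y h2
      rw [div_le_iff₀' hε] at h1
      linarith
    have := nonpos_of_re_of_boundary (v := fun z => v z - ε * (barrier S z).re) ?_ ?_ ?_ hz
    · linarith
    · intro y hy
      obtain ⟨F, hF, he⟩ := hv y hy
      refine ⟨fun y => F y - ε * barrier S y,
        hF.sub (analyticAt_const.mul (analyticAt_barrier S hy)), ?_⟩
      filter_upwards [he] with y' h
      rw [h, Complex.sub_re, Complex.re_ofReal_mul]
    · intro m hm p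
      by_cases hp : p ∈ S
      · refine hlarge _ inf_le_right ?_ m hm
        have h1 : Tendsto (fun z : ℂ => ‖z - p‖⁻¹ ^ (1 / 2 : ℝ) / 2) (𝓝[≠] (p : ℂ)) atTop :=
          ((tendsto_rpow_atTop (by norm_num)).comp
            (tendsto_inv_nhdsGT_zero.comp (tendsto_norm_sub_self_nhdsNE (p : ℂ)))).atTop_div_const
              (by norm_num)
        have h2 : 𝓝[upperHalfPlaneSet] (p : ℂ) ≤ 𝓝[≠] (p : ℂ) := by
          refine nhdsWithin_mono _ fun y hy hyp => ?_
          have hy : 0 < y.im := hy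
          rw [mem_singleton_iff.1 hyp] at hy
          simp at hy
        refine tendsto_atTop_mono' _ ?_ (h1.mono_left h2)
        filter_upwards [self_mem_nhdsWithin] with y hy using le_re_barrier_point hp hy
      · filter_upwards [(hreal p hp).eventually_lt_const hm, self_mem_nhdsWithin] with y h1 h2
        nlinarith [hb0 y h2]
    · refine hlarge _ inf_le_right ?_
      have h1 : Tendsto (fun z : ℂ => ‖z‖ ^ (1 / 2 : ℝ) / 2)
          (cocompact ℂ ⊓ 𝓟 upperHalfPlaneSet) atTop :=
        ((tendsto_rpow_atTop (by norm_num)).comp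
          ((tendsto_norm_cocompact_atTop (E := ℂ)).mono_left inf_le_left)).atTop_div_const
            (by norm_num)
      refine tendsto_atTop_mono' _ ?_ h1
      filter_upwards [mem_inf_of_right (mem_principal_self _)] with y hy using le_re_barrier_inf S hy
  have hlim : Tendsto (fun ε : ℝ => ε * (barrier S z).re) (𝓝[>] 0) (𝓝 0) := by
    have : Continuous fun ε : ℝ => ε * (barrier S z).re := by fun_prop
    simpa using (this.tendsto 0).mono_left nhdsWithin_le_nhds
  exact ge_of_tendsto hlim (by filter_upwards [self_mem_nhdsWithin] with ε hε using key ε hε)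

/-! ### The Poisson kernel of the Riemannian domain and its complexified derivative -/

section Kernel

variable {n : ℕ} {c : ℂ} {β x : Fin n → ℝ} {f : ℂ → ℂ}

lemma ae_notMem_range (x : Fin n → ℝ) : ∀ᵐ p : ℝ, p ∉ range x :=
  (finite_range x).countable.ae_notMem volume

/-- The Poisson kernel of the domain is that of the half-plane divided by the boundary speed. -/
noncomputable def domainPoisson (β x : Fin n → ℝ) (z : ℂ) (p : ℝ) : ℝ :=
  halfPlanePoisson z p / scSpeed β x p

lemma domainPoisson_mul_boundarySpeed (hc : ‖c‖ = 1)
    (hf : ∀ z : ℂ, 0 < z.im → HasDerivAt f (scIntegrand c β x z) z) (z : ℂ) {p : ℝ}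
    (hp : p ∉ range x) : domainPoisson β x z p * boundarySpeed f p = halfPlanePoisson z p := by
  rw [boundarySpeed_eq hc β hf hp, domainPoisson, div_mul_cancel₀ _ (scSpeed_pos β hp).ne']

lemma continuousOn_scSpeed (β x : Fin n → ℝ) : ContinuousOn (scSpeed β x) (range x)ᶜ :=
  fun _ hp => (hasDerivAt_scSpeed β hp).continuousAt.continuousWithinAt

lemma isPoissonKernel_domainPoisson (hc : ‖c‖ = 1)
    (hf : ∀ z : ℂ, 0 < z.im → HasDerivAt f (scIntegrand c β x z) z) :
    IsPoissonKernel f (range x) (domainPoisson β x) := by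
  have hae : ∀ z : ℂ, ∀ᵐ p : ℝ, domainPoisson β x z p * boundarySpeed f p = halfPlanePoisson z p :=
    fun z => (ae_notMem_range x).mono fun p hp => domainPoisson_mul_boundarySpeed hc hf z hp
  have hint : ∀ (φ : ℝ → ℝ) (z : ℂ), ∫ p, φ p * (domainPoisson β x z p * boundarySpeed f p) =
      ∫ p, φ p * halfPlanePoisson z p := fun φ z =>
    integral_congr_ae ((hae z).mono fun p hp => by simp only [hp])
  have hopen := (finite_range x).isClosed.isOpen_compl
  refine ⟨fun z hz => ?_, fun z hz p hp => ?_, fun z hz => ?_, fun z hz => ?_, fun φ hφ hb => ?_,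
    fun φ hφ hb p hp => ?_⟩
  · exact (continuous_halfPlanePoisson hz).continuousOn.div (continuousOn_scSpeed β x)
      fun p hp => (scSpeed_pos β hp).ne'
  · exact div_nonneg (halfPlanePoisson_nonneg hz p) (scSpeed_pos β hp).le
  · exact (integrable_halfPlanePoisson hz).congr ((hae z).mono fun p hp => hp.symm)
  · rw [integral_congr_ae (hae z)]
    exact integral_halfPlanePoisson hz
  · obtain ⟨C, hC⟩ := hb
    have hm := measurable_of_continuousOn_compl_finite (finite_range x) hφ
    refine isHarmonicOver_of_re hf (fun z hz => scIntegrand_ne_zero hc β x hz)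
      ((differentiableOn_herglotz hm hC).add_const
        ((∫ x, φ x * halfPlanePoisson Complex.I x : ℝ) : ℂ)) fun z hz => ?_
    rw [hint, poissonIntegral_eq_re hm hC hz]
  · obtain ⟨C, hC⟩ := hb
    have hm := measurable_of_continuousOn_compl_finite (finite_range x) hφ
    simp only [hint]
    exact tendsto_poissonIntegral hm hC (hφ.continuousAt (hopen.mem_nhds hp))

/-- The Poisson kernel is unique away from the corners: by the maximum principle with
finitely many exceptional points, the harmonic measure is determined by the Dirichlet problem. -/
lemma IsPoissonKernel.eq_domainPoisson (hc : ‖c‖ = 1)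
    (hf : ∀ z : ℂ, 0 < z.im → HasDerivAt f (scIntegrand c β x z) z) {k : ℂ → ℝ → ℝ}
    (hk : IsPoissonKernel f (range x) k) {z : ℂ} (hz : 0 < z.im) {p : ℝ} (hp : p ∉ range x) :
    k z p = domainPoisson β x z p := by
  have hk₀ := isPoissonKernel_domainPoisson hc hf
  have hf' : ∀ z : ℂ, 0 < z.im → scIntegrand c β x z ≠ 0 := fun z hz =>
    scIntegrand_ne_zero hc β x hz
  -- One of the two Poisson integrals is at most the other; the roles are symmetric.
  have hle : ∀ k k' : ℂ → ℝ → ℝ, IsPoissonKernel f (range x) k → IsPoissonKernel f (range x) k' →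
      ∀ φ : ℝ → ℝ, Continuous φ → (∃ C, ∀ p, |φ p| ≤ C) → ∀ z : ℂ, 0 < z.im →
      (∫ p, φ p * (k z p * boundarySpeed f p)) - ∫ p, φ p * (k' z p * boundarySpeed f p) ≤ 0 := by
    intro k k' hk hk' φ hφ hb z hz
    obtain ⟨C, hC⟩ := hb
    have hbound : ∀ k : ℂ → ℝ → ℝ, IsPoissonKernel f (range x) k → ∀ z : ℂ, 0 < z.im →
        |∫ p, φ p * (k z p * boundarySpeed f p)| ≤ C := by
      intro k hk z hz
      refine abs_poissonIntegral_le hC (hk.integrable z hz) ?_ (hk.mass z hz)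
      filter_upwards [ae_notMem_range x] with p hp
      refine mul_nonneg (hk.nonneg z hz p hp) ?_
      rw [boundarySpeed_eq hc β hf hp]
      exact (scSpeed_pos β hp).le
    refine nonpos_of_re_of_bounded (v := fun z => (∫ p, φ p * (k z p * boundarySpeed f p)) -
      ∫ p, φ p * (k' z p * boundarySpeed f p)) (finite_range x) (fun z hz => ?_) (C := C + C)
      (fun z hz => ?_) (fun p hp => ?_) hz
    · obtain ⟨F, hF, h⟩ := (hk.harmonic φ hφ.continuousOn ⟨C, hC⟩).exists_re_eq hf hf' hz
      obtain ⟨F', hF', h'⟩ := (hk'.harmonic φ hφ.continuousOn ⟨C, hC⟩).exists_re_eq hf hf' hz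
      refine ⟨fun y => F y - F' y, hF.sub hF', ?_⟩
      filter_upwards [h, h'] with y h1 h2
      rw [h1, h2, Complex.sub_re]
    · have h1 := (abs_le.1 (hbound k hk z hz)).2
      have h2 := (abs_le.1 (hbound k' hk' z hz)).1
      linarith
    · have := (hk.boundary φ hφ.continuousOn ⟨C, hC⟩ p hp).sub
        (hk'.boundary φ hφ.continuousOn ⟨C, hC⟩ p hp)
      rwa [sub_self] at this
  have heq : ∀ᵐ p : ℝ, k z p * boundarySpeed f p - domainPoisson β x z p * boundarySpeed f p = 0 := by
    refine ae_eq_zero_of_integral_contDiff_smul_eq_zero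
      ((hk.integrable z hz).sub (hk₀.integrable z hz)).locallyIntegrable fun φ hφ hsupp => ?_
    have hφc := hφ.continuous
    obtain ⟨C, hC⟩ := hφc.bounded_above_of_compact_support hsupp
    have hi : ∀ k : ℂ → ℝ → ℝ, IsPoissonKernel f (range x) k →
        Integrable fun p => φ p * (k z p * boundarySpeed f p) := fun k hk =>
      (hk.integrable z hz).bdd_mul hφc.aestronglyMeasurable (Eventually.of_forall hC)
    simp only [smul_eq_mul, mul_sub]
    rw [integral_sub (hi k hk) (hi _ hk₀)]
    have h1 := hle k _ hk hk₀ φ hφc ⟨C, hC⟩ z hz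
    have h2 := hle _ k hk₀ hk φ hφc ⟨C, hC⟩ z hz
    linarith
  have hopen := (finite_range x).isClosed.isOpen_compl
  have hbs : ContinuousOn (boundarySpeed f) (range x)ᶜ :=
    (continuousOn_scSpeed β x).congr fun p hp => boundarySpeed_eq hc β hf hp
  have hEq := Measure.eqOn_open_of_ae_eq (μ := volume)
    (f := fun p => k z p * boundarySpeed f p)
    (g := fun p => domainPoisson β x z p * boundarySpeed f p)
    (ae_restrict_of_ae (heq.mono fun p hp => sub_eq_zero.1 hp)) hopen
    ((hk.cont z hz).mul hbs) ((hk₀.cont z hz).mul hbs) hp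
  refine mul_right_cancel₀ ?_ hEq
  rw [boundarySpeed_eq hc β hf hp]
  exact (scSpeed_pos β hp).ne'

/-- The complexified derivative of the Poisson kernel at the boundary point `w`. -/
noncomputable def domainPoissonDeriv (β x : Fin n → ℝ) (w : ℝ) (z : ℂ) : ℂ :=
  ((scSpeed β x w ^ 2)⁻¹ : ℝ) * ((Real.pi⁻¹ : ℝ) * (Complex.I / (z - w) ^ 2 +
    (∑ k, β k / (w - x k) : ℝ) * (Complex.I / (z - w))))

lemma hasDerivAt_halfPlanePoisson {z : ℂ} (hz : 0 < z.im) (w : ℝ) :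
    HasDerivAt (halfPlanePoisson z) (Real.pi⁻¹ * (Complex.I / (z - w) ^ 2).re) w := by
  have hne := ofReal_sub_ne_zero hz w
  have h0 : HasDerivAt (fun y : ℝ => (y : ℂ)) 1 w := Complex.ofRealCLM.hasDerivAt
  have h1 := (((h0.sub_const z).inv hne).const_mul (Real.pi * Complex.I : ℂ)⁻¹)
  have h2 := Complex.reCLM.hasFDerivAt.comp_hasDerivAt w h1
  have h3 : halfPlanePoisson z = fun y : ℝ =>
      ((Real.pi * Complex.I : ℂ)⁻¹ * ((y : ℂ) - z)⁻¹).re := funext fun y => halfPlanePoisson_eq_re z y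
  rw [h3]
  refine h2.congr_deriv ?_
  simp only [Complex.reCLM_apply]
  rw [← Complex.re_ofReal_mul]
  congr 1
  have hne' := sub_ofReal_ne_zero hz w
  have hpi : (Real.pi : ℂ) ≠ 0 := Complex.ofReal_ne_zero.2 Real.pi_ne_zero
  rw [mul_inv, Complex.inv_I, Complex.ofReal_inv, ← neg_sub z (w : ℂ), neg_sq]
  field_simp

lemma halfPlanePoisson_eq_re' (z : ℂ) (w : ℝ) :
    halfPlanePoisson z w = Real.pi⁻¹ * (Complex.I / (z - w)).re := by
  rw [halfPlanePoisson_eq_re, ← Complex.re_ofReal_mul, mul_inv, Complex.inv_I, Complex.ofReal_inv,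
    ← neg_sub z (w : ℂ), inv_neg]
  congr 1
  ring

lemma hasDerivAt_domainPoisson (β : Fin n → ℝ) {z : ℂ} (hz : 0 < z.im) {w : ℝ}
    (hw : w ∉ range x) :
    HasDerivAt (domainPoisson β x z) ((domainPoissonDeriv β x w z).re * scSpeed β x w) w := by
  have hs := (scSpeed_pos β hw).ne'
  refine ((hasDerivAt_halfPlanePoisson hz w).div (hasDerivAt_scSpeed β hw) hs).congr_deriv ?_
  rw [domainPoissonDeriv, Complex.re_ofReal_mul, Complex.re_ofReal_mul, Complex.add_re,
    Complex.re_ofReal_mul, halfPlanePoisson_eq_re']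
  have : ∑ k, -β k / (w - x k) = -∑ k, β k / (w - x k) := by
    rw [← Finset.sum_neg_distrib]
    exact Finset.sum_congr rfl fun k _ => neg_div _ _
  rw [this]
  field_simp
  ring

lemma isComplexifiedDeriv_domainPoissonDeriv (hc : ‖c‖ = 1)
    (hf : ∀ z : ℂ, 0 < z.im → HasDerivAt f (scIntegrand c β x z) z) {w : ℝ} (hw : w ∉ range x) :
    IsComplexifiedDeriv f (domainPoisson β x) w (domainPoissonDeriv β x w) := by
  refine ⟨fun V φ h => ?_, fun z hz => ?_, ?_⟩
  · have hd : DifferentiableOn ℂ φ V := fun q hq =>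
      (h.hasDerivAt hf (fun z hz => scIntegrand_ne_zero hc β x hz) hq).differentiableAt
        |>.differentiableWithinAt
    have hne : ∀ q ∈ V, φ q - w ≠ 0 := fun q hq => sub_ofReal_ne_zero (h.2.2.1 hq) w
    refine DifferentiableOn.const_mul (DifferentiableOn.const_mul (DifferentiableOn.add ?_ ?_) _) _
    · exact (differentiableOn_const _).div ((hd.sub_const _).pow 2) fun q hq =>
        pow_ne_zero 2 (hne q hq)
    · exact ((differentiableOn_const _).div (hd.sub_const _) hne).const_mul _
  · rw [boundarySpeed_eq hc β hf hw]
    exact hasDerivAt_domainPoisson β hz hw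
  · have h1 : Tendsto (fun z : ℂ => (z - w)⁻¹) (cocompact ℂ) (𝓝 0) := by
      rw [← Metric.cobounded_eq_cocompact]
      exact tendsto_inv₀_cobounded.comp
        (tendsto_sub_const_cobounded (w : ℂ))
    have h2 : Tendsto (fun z : ℂ => ((scSpeed β x w ^ 2)⁻¹ : ℝ) * ((Real.pi⁻¹ : ℝ) *
        (Complex.I * ((z - w)⁻¹) ^ 2 +
          (∑ k, β k / (w - x k) : ℝ) * (Complex.I * (z - w)⁻¹)))) (cocompact ℂ) (𝓝 0) := by
      have := (((h1.pow 2).const_mul Complex.I).add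
        ((h1.const_mul Complex.I).const_mul ((∑ k, β k / (w - x k) : ℝ) : ℂ))).const_mul
          ((Real.pi⁻¹ : ℝ) : ℂ) |>.const_mul (((scSpeed β x w ^ 2)⁻¹ : ℝ) : ℂ)
      simpa using this
    refine (h2.mono_left inf_le_left).congr fun z => ?_
    rw [domainPoissonDeriv, div_eq_mul_inv, div_eq_mul_inv, inv_pow]

/-- A holomorphic function on the half-plane whose real part vanishes, and which vanishes at `∞`, is
zero. -/
lemma eq_zero_of_re_eq_zero {G : ℂ → ℂ} (hG : ∀ z : ℂ, 0 < z.im → DifferentiableAt ℂ G z)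
    (hre : ∀ z : ℂ, 0 < z.im → (G z).re = 0)
    (hlim : Tendsto G (cocompact ℂ ⊓ 𝓟 upperHalfPlaneSet) (𝓝 0)) {z : ℂ} (hz : 0 < z.im) :
    G z = 0 := by
  have hopen := UpperHalfPlane.isOpen_upperHalfPlaneSet
  have hderiv : ∀ y : ℂ, 0 < y.im → deriv G y = 0 := by
    intro y hy
    have hloc : ∀ᶠ y' in 𝓝 y, Complex.exp (G y') = Complex.exp (G y) := by
      refine Complex.eventually_eq_of_isLocalMax_norm (f := fun y => Complex.exp (G y)) ?_ ?_
      · filter_upwards [hopen.mem_nhds hy] with y' hy' using (hG y' hy').cexp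
      · filter_upwards [hopen.mem_nhds hy] with y' hy'
        simp only [Function.comp_apply, Complex.norm_exp]
        rw [hre y hy, hre y' hy']
    have h1 : HasDerivAt (fun y => Complex.exp (G y)) 0 y :=
      (hasDerivAt_const y (Complex.exp (G y))).congr_of_eventuallyEq hloc
    exact (mul_eq_zero.1 ((hG y hy).hasDerivAt.cexp.unique h1)).resolve_left (Complex.exp_ne_zero _)
  have hconst : ∀ y : ℂ, 0 < y.im → G y = G z := fun y hy =>
    hopen.is_const_of_deriv_eq_zero (convex_halfSpace_im_gt 0).isPreconnected
      (fun y hy => (hG y hy).differentiableWithinAt) (fun y hy => hderiv y hy) hy hz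
  have hray : Tendsto (fun r : ℝ => (r : ℂ) * Complex.I) atTop
      (cocompact ℂ ⊓ 𝓟 upperHalfPlaneSet) := by
    refine tendsto_inf.2 ⟨?_, tendsto_principal.2 ?_⟩
    · rw [← Metric.cobounded_eq_cocompact, ← tendsto_norm_atTop_iff_cobounded]
      simpa using tendsto_abs_atTop_atTop
    · filter_upwards [eventually_gt_atTop 0] with r hr
      simpa using hr
  have h0 := hlim.comp hray
  refine tendsto_nhds_unique (tendsto_const_nhds.congr' ?_) h0
  filter_upwards [eventually_gt_atTop 0] with r hr
  exact (hconst _ (by simpa using hr)).symm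

lemma IsComplexifiedDeriv.eq_domainPoissonDeriv (hc : ‖c‖ = 1)
    (hf : ∀ z : ℂ, 0 < z.im → HasDerivAt f (scIntegrand c β x z) z) {w : ℝ} (hw : w ∉ range x)
    {k : ℂ → ℝ → ℝ} (hk : IsPoissonKernel f (range x) k) {H : ℂ → ℂ}
    (hH : IsComplexifiedDeriv f k w H) {z : ℂ} (hz : 0 < z.im) :
    H z = domainPoissonDeriv β x w z := by
  have hf' : ∀ z : ℂ, 0 < z.im → scIntegrand c β x z ≠ 0 := fun z hz =>
    scIntegrand_ne_zero hc β x hz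
  have hH₀ := isComplexifiedDeriv_domainPoissonDeriv hc hf hw
  refine sub_eq_zero.1 (eq_zero_of_re_eq_zero (G := fun z => H z - domainPoissonDeriv β x w z)
    (fun z hz => (hH.analytic.differentiableAt hf hf' hz).sub
      (hH₀.analytic.differentiableAt hf hf' hz)) (fun z hz => ?_) ?_ hz)
  · have h1 := hH.re_eq z hz
    have h2 := (hH₀.re_eq z hz).congr_of_eventuallyEq (f₁ := k z) (by
      filter_upwards [(finite_range x).isClosed.isOpen_compl.mem_nhds hw] with p hp
      exact hk.eq_domainPoisson hc hf hz hp)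
    have h3 := h1.unique h2
    rw [boundarySpeed_eq hc β hf hw] at h3
    rw [Complex.sub_re, mul_right_cancel₀ (scSpeed_pos β hw).ne' h3, sub_self]
  · simpa using hH.vanish.sub hH₀.vanish

end Kernel

/-! ### The prevertices -/

/-- The driving function `w` and the prevertices `x_k`, which flow along the Loewner equation on
`[0, T]` and do not meet `w`. -/
structure IsPrevertexFlow {n : ℕ} (w : ℝ → ℝ) (x : Fin n → ℝ → ℝ) (T : ℝ) : Prop where
  cont : ContinuousOn w (Icc 0 T)
  init : w 0 = 0
  init_ne : ∀ k, x k 0 ≠ 0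
  ne : ∀ k, ∀ s ∈ Icc 0 T, x k s ≠ w s
  deriv : ∀ k, ∀ s ∈ Icc 0 T, HasDerivWithinAt (x k) (2 / (x k s - w s)) (Icc 0 T) s

lemma IsPrevertexFlow.mono {n : ℕ} {w : ℝ → ℝ} {x : Fin n → ℝ → ℝ} {T T' : ℝ}
    (h : IsPrevertexFlow w x T) (hT : T' ≤ T) : IsPrevertexFlow w x T' where
  cont := h.cont.mono (Icc_subset_Icc_right hT)
  init := h.init
  init_ne := h.init_ne
  ne k s hs := h.ne k s ⟨hs.1, hs.2.trans hT⟩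
  deriv k s hs := (h.deriv k s ⟨hs.1, hs.2.trans hT⟩).mono (Icc_subset_Icc_right hT)

/-- A prevertex to the left of the driving function moves to the left. -/
lemma prevertex_neg {w y : ℝ → ℝ} {T : ℝ} (hw : ContinuousOn w (Icc 0 T)) (hw0 : w 0 = 0)
    (hne : ∀ s ∈ Icc 0 T, y s ≠ w s)
    (hd : ∀ s ∈ Icc 0 T, HasDerivWithinAt y (2 / (y s - w s)) (Icc 0 T) s) (h0 : y 0 < 0)
    {s : ℝ} (hs : s ∈ Icc 0 T) : y s < 0 ∧ y s < w s := by
  have hy : ContinuousOn y (Icc 0 T) := fun s hs => (hd s hs).continuousWithinAt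
  have hlt : ∀ s ∈ Icc 0 T, y s < w s := by
    intro s hs
    by_contra! hge
    obtain ⟨r, hr, he⟩ := intermediate_value_Icc hs.1
      ((hy.sub hw).mono (Icc_subset_Icc_right hs.2))
      (show (0 : ℝ) ∈ Icc (y 0 - w 0) (y s - w s) from ⟨by linarith, by linarith⟩)
    exact hne r ⟨hr.1, hr.2.trans hs.2⟩ (sub_eq_zero.1 he)
  have hanti : AntitoneOn y (Icc 0 T) := by
    refine antitoneOn_of_hasDerivWithinAt_nonpos (convex_Icc 0 T) hy
      (fun s hs => (hd s (interior_subset hs)).mono interior_subset) fun s hs => ?_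
    exact div_nonpos_of_nonneg_of_nonpos zero_le_two
      (sub_nonpos.2 (hlt s (interior_subset hs)).le)
  exact ⟨(hanti ⟨le_rfl, hs.1.trans hs.2⟩ hs hs.1).trans_lt h0, hlt s hs⟩

/-- The driving function and `0` stay in the same interval between the prevertices; so
`SC_t` is regular at both. -/
lemma IsPrevertexFlow.separated {n : ℕ} {w : ℝ → ℝ} {x : Fin n → ℝ → ℝ} {T : ℝ}
    (h : IsPrevertexFlow w x T) {s : ℝ} (hs : s ∈ Icc 0 T) (k : Fin n) :
    x k s < 0 ∧ x k s < w s ∨ 0 < x k s ∧ w s < x k s := by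
  rcases lt_or_gt_of_ne (h.init_ne k) with h0 | h0
  · exact Or.inl (prevertex_neg h.cont h.init (h.ne k) (h.deriv k) h0 hs)
  · right
    have := prevertex_neg (w := fun s => -w s) (y := fun s => -x k s) h.cont.neg
      (by simp [h.init]) (fun s hs he => h.ne k s hs (neg_injective he))
      (fun s hs => (h.deriv k s hs).neg.congr_deriv (by
        rw [← div_neg]; congr 1; ring)) (by simpa using h0) hs
    exact ⟨by linarith [this.1], by linarith [this.2]⟩

lemma IsPrevertexFlow.ne_zero {n : ℕ} {w : ℝ → ℝ} {x : Fin n → ℝ → ℝ} {T : ℝ}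
    (h : IsPrevertexFlow w x T) {s : ℝ} (hs : s ∈ Icc 0 T) (k : Fin n) : x k s ≠ 0 :=
  (h.separated hs k).elim (fun h => h.1.ne) (fun h => h.1.ne')

lemma IsPrevertexFlow.notMem_range {n : ℕ} {w : ℝ → ℝ} {x : Fin n → ℝ → ℝ} {T : ℝ}
    (h : IsPrevertexFlow w x T) {s : ℝ} (hs : s ∈ Icc 0 T) : w s ∉ range fun k => x k s := by
  rintro ⟨k, hk⟩
  exact h.ne k s hs hk

/-! ### The logarithmic derivative of the polygon flow -/

lemma isLoewnerSolution_loewnerMap {w : ℝ → ℝ} {z : ℂ} {T : ℝ} {γ : ℝ → ℂ}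
    (h : IsLoewnerSolution w z T γ) (hT : 0 ≤ T) (hw : ContinuousOn w (Icc 0 T)) :
    IsLoewnerSolution w z T (fun s => loewnerMap w s z) := by
  have heq : ∀ s ∈ Icc 0 T, loewnerMap w s z = γ s := fun s hs =>
    loewnerMap_eq h hs.1 hs.2 (hw.mono (Icc_subset_Icc_right hs.2))
  refine ⟨(heq 0 ⟨le_rfl, hT⟩).trans h.1, fun s hs => ?_⟩
  simp only [heq s hs]
  exact ⟨(h.2 s hs).1, (h.2 s hs).2.congr heq (heq s hs)⟩

lemma loewnerMap_zero {w : ℝ → ℝ} {z : ℂ} (hz : 0 < z.im) : loewnerMap w 0 z = z := by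
  have h : IsLoewnerSolution w z 0 fun _ => z := by
    refine ⟨rfl, fun s hs => ⟨sub_ne_zero.1 (sub_ofReal_ne_zero hz _), ?_⟩⟩
    · rw [Icc_self, mem_singleton_iff] at hs
      rw [hs, Icc_self]
      exact HasFDerivWithinAt.of_subsingleton subsingleton_singleton
  exact loewnerMap_eq h le_rfl le_rfl (by rw [Icc_self]; exact continuousOn_singleton _ _)

/-- The logarithm of `h_t'(q)` for `h_t = f_t ∘ g_t ∘ f_0⁻¹`, at the point `q = f_0(ζ)`. -/
noncomputable def logDerivPolygonFlow {n : ℕ} (β : Fin n → ℝ) (w : ℝ → ℝ) (x : Fin n → ℝ → ℝ) (ζ : ℂ)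
    (t : ℝ) : ℂ :=
  (∑ k, -(β k : ℂ) * (Complex.log (loewnerMap w t ζ - x k t) - Complex.log (ζ - x k 0))) +
    ∫ s in (0 : ℝ)..t, -2 / (loewnerMap w s ζ - w s) ^ 2

lemma logDerivPolygonFlow_zero {n : ℕ} (β : Fin n → ℝ) (w : ℝ → ℝ) (x : Fin n → ℝ → ℝ) {ζ : ℂ}
    (hζ : 0 < ζ.im) : logDerivPolygonFlow β w x ζ 0 = 0 := by
  simp [logDerivPolygonFlow, loewnerMap_zero hζ]

lemma exp_logDerivPolygonFlow {n : ℕ} {c : ℂ} (hc : c ≠ 0) (β : Fin n → ℝ) (w : ℝ → ℝ) (x : Fin n → ℝ → ℝ)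
    {ζ : ℂ} (hζ : 0 < ζ.im) {t : ℝ} (hg : 0 < (loewnerMap w t ζ).im) :
    Complex.exp (logDerivPolygonFlow β w x ζ t) =
      scIntegrand c β (fun k => x k t) (loewnerMap w t ζ) *
        (Complex.exp (∫ s in (0 : ℝ)..t, -2 / (loewnerMap w s ζ - w s) ^ 2) *
          (scIntegrand c β (fun k => x k 0) ζ)⁻¹) := by
  have h : ∀ k, Complex.exp (-(β k : ℂ) *
      (Complex.log (loewnerMap w t ζ - x k t) - Complex.log (ζ - x k 0))) =
      (loewnerMap w t ζ - x k t) ^ (-(β k : ℂ)) * ((ζ - x k 0) ^ (-(β k : ℂ)))⁻¹ := by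
    intro k
    rw [Complex.cpow_def_of_ne_zero (sub_ofReal_ne_zero hg _),
      Complex.cpow_def_of_ne_zero (sub_ofReal_ne_zero hζ _), ← Complex.exp_neg, ← Complex.exp_add]
    congr 1
    ring
  rw [logDerivPolygonFlow, Complex.exp_add, Complex.exp_sum]
  simp only [h, scIntegrand, Finset.prod_mul_distrib, Finset.prod_inv_distrib, mul_inv]
  field_simp

/-- The Loewner equation for `ln h_t'`. -/
lemma hasDerivWithinAt_logDerivPolygonFlow {n : ℕ} (β : Fin n → ℝ) {w : ℝ → ℝ} {x : Fin n → ℝ → ℝ} {T : ℝ}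
    (h : IsPrevertexFlow w x T) {ζ : ℂ} (hζ : 0 < ζ.im) {γ : ℝ → ℂ}
    (hγ : IsLoewnerSolution w ζ T γ) {t : ℝ} (ht : t ∈ Icc 0 T) :
    HasDerivWithinAt (logDerivPolygonFlow β w x ζ)
      (2 * Real.pi * Complex.I * (scSpeed β (fun k => x k t) (w t) : ℂ) ^ 2 *
        domainPoissonDeriv β (fun k => x k t) (w t) (loewnerMap w t ζ)) (Icc 0 T) t := by
  have hg := isLoewnerSolution_loewnerMap hγ (ht.1.trans ht.2) h.cont
  have him : ∀ s ∈ Icc 0 T, 0 < (loewnerMap w s ζ).im := fun s hs => hg.im_pos h.cont hζ hs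
  have hint : ContinuousOn (fun s => -2 / (loewnerMap w s ζ - w s) ^ 2) (Icc 0 T) :=
    continuousOn_const.div ((hg.continuousOn_sub h.cont).pow 2)
      fun s hs => pow_ne_zero 2 (hg.sub_ne_zero hs)
  have hlog : ∀ k, HasDerivWithinAt (fun s => -(β k : ℂ) *
      (Complex.log (loewnerMap w s ζ - x k s) - Complex.log (ζ - x k 0)))
      (-(β k : ℂ) * ((2 / (loewnerMap w t ζ - w t) - ((2 / (x k t - w t) : ℝ) : ℂ)) /
        (loewnerMap w t ζ - x k t))) (Icc 0 T) t := by
    intro k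
    have hx : HasDerivWithinAt (fun s => (x k s : ℂ)) ((2 / (x k t - w t) : ℝ) : ℂ) (Icc 0 T) t := by
      have := Complex.ofRealCLM.hasFDerivAt.comp_hasDerivWithinAt t (h.deriv k t ht)
      exact this
    refine (HasDerivWithinAt.sub_const _ (HasDerivWithinAt.clog_real ((hg.2 t ht).2.sub hx)
      (Or.inr ?_))).const_mul _
    simpa using (him t ht).ne'
  refine ((HasDerivWithinAt.fun_sum fun k _ => hlog k).add
    (hasDerivWithinAt_integral_Icc hint ht)).congr_deriv ?_
  have hs : (scSpeed β (fun k => x k t) (w t) : ℂ) ≠ 0 :=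
    Complex.ofReal_ne_zero.2 (scSpeed_pos β (h.notMem_range ht)).ne'
  have hpi : (Real.pi : ℂ) ≠ 0 := Complex.ofReal_ne_zero.2 Real.pi_ne_zero
  have hgw := hg.sub_ne_zero ht
  have hsum : ∀ k, -(β k : ℂ) * ((2 / (loewnerMap w t ζ - w t) - ((2 / (x k t - w t) : ℝ) : ℂ)) /
      (loewnerMap w t ζ - x k t)) =
      -2 / (loewnerMap w t ζ - w t) * ((β k / (w t - x k t) : ℝ) : ℂ) := by
    intro k
    have h1 : (x k t : ℂ) - w t ≠ 0 := by
      rw [← Complex.ofReal_sub]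
      exact Complex.ofReal_ne_zero.2 (sub_ne_zero.2 (h.ne k t ht))
    have h2 : (w t : ℂ) - x k t ≠ 0 := by rw [← neg_sub]; exact neg_ne_zero.2 h1
    have h3 := sub_ofReal_ne_zero (him t ht) (x k t)
    push_cast
    field_simp
    ring
  -- both sides are `-2 / (g - w)² - 2 / (g - w) ∑ β_k / (w - x_k)`
  simp only [hsum]
  rw [← Finset.mul_sum, domainPoissonDeriv]
  push_cast
  have hI : Complex.I * Complex.I = -1 := Complex.I_mul_I
  field_simp
  linear_combination -(1 + (∑ k, (β k : ℂ) / (w t - x k t)) * (loewnerMap w t ζ - w t)) * hI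

/-- The paths of a solution of the SLE(κ, ρ) equations form a prevertex flow up to any time before
the first collision. -/
lemma isPrevertexFlow_path {Ω : Type*} {n : ℕ} {W : ℝ≥0 → Ω → ℝ} {Z : Fin n → ℝ≥0 → Ω → ℝ}
    {τ : Ω → ℝ≥0∞} {z : Fin n → ℝ} (hz0 : ∀ k, z k ≠ 0) {ω : Ω} (hW0 : W 0 ω = 0)
    (hZ0 : ∀ k, Z k 0 ω = z k)
    (hcW : ContinuousOn (fun t => W t ω) {t | (t : ℝ≥0∞) < τ ω})
    (hcZ : ∀ k, ContinuousOn (fun t => Z k t ω) {t | (t : ℝ≥0∞) < τ ω})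
    (heZ : ∀ t : ℝ≥0, (t : ℝ≥0∞) < τ ω → ∀ k,
      Z k t ω = z k + ∫ s in (0 : ℝ)..t, 2 / (path (Z k) ω s - path W ω s))
    {t : ℝ} (ht0 : 0 ≤ t) (ht : ENNReal.ofReal t < collisionTime W Z τ ω) :
    ∃ T > t, IsPrevertexFlow (path W ω) (fun k => path (Z k) ω) T := by
  simp only [collisionTime, lt_iSup_iff] at ht
  obtain ⟨T, ⟨hTτ, hdist⟩, hlt⟩ := ht
  have hlt' : t < T := by
    rw [← ENNReal.ofReal_coe_nnreal] at hlt
    exact (ENNReal.ofReal_lt_ofReal_iff_of_nonneg ht0).1 hlt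
  have hle : ∀ s ∈ Icc (0 : ℝ) T, s.toNNReal ≤ T := fun s hs => Real.toNNReal_le_iff_le_coe.2 hs.2
  have hmaps : MapsTo Real.toNNReal (Icc (0 : ℝ) T) {t | (t : ℝ≥0∞) < τ ω} := fun s hs =>
    lt_of_le_of_lt (ENNReal.coe_le_coe.2 (hle s hs)) hTτ
  have hw : ContinuousOn (path W ω) (Icc 0 T) :=
    hcW.comp continuous_real_toNNReal.continuousOn hmaps
  have hne : ∀ k, ∀ s ∈ Icc (0 : ℝ) T, path (Z k) ω s ≠ path W ω s := fun k s hs =>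
    ((hdist _ (hle s hs)).1 k).symm
  refine ⟨T, hlt', hw, by simpa [path] using hW0, fun k => ?_, hne, fun k s hs => ?_⟩
  · simpa [path, hZ0 k] using hz0 k
  · have hx : ContinuousOn (path (Z k) ω) (Icc 0 T) :=
      (hcZ k).comp continuous_real_toNNReal.continuousOn hmaps
    have hint : ContinuousOn (fun s => 2 / (path (Z k) ω s - path W ω s)) (Icc 0 T) :=
      continuousOn_const.div (hx.sub hw) fun s hs => sub_ne_zero.2 (hne k s hs)
    have heq : ∀ s ∈ Icc (0 : ℝ) T, path (Z k) ω s =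
        z k + ∫ r in (0 : ℝ)..s, 2 / (path (Z k) ω r - path W ω r) := by
      intro s hs
      have := heZ s.toNNReal (hmaps hs) k
      rwa [Real.coe_toNNReal s hs.1] at this
    exact ((hasDerivWithinAt_integral_Icc hint hs).const_add (z k)).congr heq (heq s hs)

end PolygonLoewner

theorem mainTheorem1 {Ω : Type*} {mΩ : MeasurableSpace Ω} (P : Measure Ω) [IsProbabilityMeasure P]
    (𝓕 : Filtration ℝ≥0 mΩ) {n : ℕ} (κ : ℝ) (hκ : 0 < κ)
    (β ρ z : Fin n → ℝ) (hρ : ∀ k, ρ k = κ / 2 * β k)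
    (hz : Function.Injective z) (hz0 : ∀ k, z k ≠ 0)
    (B W : ℝ≥0 → Ω → ℝ) (Z : Fin n → ℝ≥0 → Ω → ℝ) (τ : Ω → ℝ≥0∞)
    (hSLE : PolygonLoewner.IsSLEKappaRho P 𝓕 κ ρ z B W Z τ)
    (c : ℂ) (hc : ‖c‖ = 1) :
    ∀ᵐ ω ∂P,
      let w : ℝ → ℝ := PolygonLoewner.path W ω
      let x : Fin n → ℝ → ℝ := fun k => PolygonLoewner.path (Z k) ω
      let σ : ℝ≥0∞ := PolygonLoewner.collisionTime W Z τ ω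
      let K : ℝ → Set ℂ := PolygonLoewner.loewnerHull w
      let g : ℝ → ℂ → ℂ := PolygonLoewner.loewnerMap w
      let f : ℝ → ℂ → ℂ := PolygonLoewner.polygonMap c β w x
      -- `g t` is the normalised conformal map of the complement of the hull onto `ℍ`
      (∀ t : ℝ, 0 ≤ t → ENNReal.ofReal t < σ →
        BijOn (g t) (upperHalfPlaneSet \ K t) upperHalfPlaneSet ∧
        DifferentiableOn ℂ (g t) (upperHalfPlaneSet \ K t) ∧
        Tendsto (fun ζ => g t ζ - ζ) (cocompact ℂ ⊓ 𝓟 (upperHalfPlaneSet \ K t)) (𝓝 0)) ∧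
      -- when `f_0` is injective, its inverse on `D = f_0(ℍ)` is a branch, and
      -- `h_t = f_t ∘ g_t ∘ f_0⁻¹` maps the complement of `f_0(K_t)` onto `D_t`
      (InjOn (f 0) upperHalfPlaneSet →
        PolygonLoewner.IsFlatChart (f 0) (f 0 '' upperHalfPlaneSet)
          (Function.invFunOn (f 0) upperHalfPlaneSet) ∧
        ∀ t : ℝ, 0 ≤ t → ENNReal.ofReal t < σ →
          (fun q => f t (g t (Function.invFunOn (f 0) upperHalfPlaneSet q))) ''
            (f 0 '' upperHalfPlaneSet \ f 0 '' (K t ∩ upperHalfPlaneSet)) =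
              f t '' upperHalfPlaneSet) ∧
      -- the Poisson kernel of `D_t` and its complexified derivative exist
      (∀ t : ℝ, 0 ≤ t → ENNReal.ofReal t < σ →
        ∃ k H, PolygonLoewner.IsPoissonKernel (f t) (range fun j => x j t) k ∧
          PolygonLoewner.IsComplexifiedDeriv (f t) k (w t) H) ∧
      -- the Loewner equation for `h_t = f_t ∘ g_t ∘ f_0⁻¹`, for every branch `φ` of `f_0⁻¹`
      ∀ (V : Set ℂ) (φ : ℂ → ℂ), PolygonLoewner.IsFlatChart (f 0) V φ → ∀ q ∈ V,
        ∃ L : ℝ → ℂ, L 0 = 0 ∧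
          ∀ t : ℝ, 0 ≤ t → ENNReal.ofReal t < σ → φ q ∉ K t →
            Complex.exp (L t) = deriv (fun p => f t (g t (φ p))) q ∧
            ∀ k H, PolygonLoewner.IsPoissonKernel (f t) (range fun j => x j t) k →
              PolygonLoewner.IsComplexifiedDeriv (f t) k (w t) H →
              HasDerivWithinAt L
                (2 * Real.pi * Complex.I *
                  (‖deriv (fun y : ℝ => f t y) (w t)‖ : ℂ) ^ 2 * H (g t (φ q)))
                (Ici 0) t := by
  open PolygonLoewner in
  filter_upwards [hSLE.init_W, hSLE.init_Z, hSLE.cont_W, hSLE.cont_Z, hSLE.eq_Z]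
    with ω hW0 hZ0 hcW hcZ heZ
  intro w x σ K g f
  have hc0 : c ≠ 0 := norm_ne_zero_iff.1 (by rw [hc]; exact one_ne_zero)
  have hflow : ∀ t : ℝ, 0 ≤ t → ENNReal.ofReal t < σ → ∃ T > t, IsPrevertexFlow w x T :=
    fun t ht0 ht => isPrevertexFlow_path hz0 hW0 hZ0 hcW hcZ heZ ht0 ht
  have hf : ∀ t : ℝ, 0 ≤ t → ENNReal.ofReal t < σ → ∀ y : ℂ, 0 < y.im →
      HasDerivAt (f t) (scIntegrand c β (fun k => x k t) y) y := by
    intro t ht0 ht y hy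
    obtain ⟨T, hT, hfl⟩ := hflow t ht0 ht
    exact hasDerivAt_polygonMap c β w (fun k => hfl.ne_zero ⟨ht0, hT.le⟩ k) hy
  have hf0 : ∀ y : ℂ, 0 < y.im → HasDerivAt (f 0) (scIntegrand c β (fun k => x k 0) y) y := by
    intro y hy
    refine hasDerivAt_polygonMap c β w (fun k => ?_) hy
    simpa [x, path, hZ0 k] using hz0 k
  have hne0 : ∀ y : ℂ, 0 < y.im → scIntegrand c β (fun k => x k 0) y ≠ 0 := fun y hy =>
    scIntegrand_ne_zero hc β _ hy
  have hbij : ∀ t : ℝ, 0 ≤ t → ENNReal.ofReal t < σ →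
      BijOn (g t) (upperHalfPlaneSet \ K t) upperHalfPlaneSet := by
    intro t ht0 ht
    obtain ⟨T, hT, hfl⟩ := hflow t ht0 ht
    exact bijOn_loewnerMap hfl.cont ⟨ht0, hT⟩
  refine ⟨fun t ht0 ht => ⟨hbij t ht0 ht, ?_, ?_⟩, fun hinj => ⟨isFlatChart_invFunOn hf0 hne0 hinj,
    fun t ht0 ht => ?_⟩, fun t ht0 ht => ?_, fun V φ hφ q hq => ⟨logDerivPolygonFlow β w x (φ q),
    logDerivPolygonFlow_zero β w x (hφ.2.2.1 hq), fun t ht0 ht hK => ?_⟩⟩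
  · obtain ⟨T, hT, hfl⟩ := hflow t ht0 ht
    intro y hy
    obtain ⟨him, t', hlt, γ, hγ⟩ := (mem_diff_loewnerHull_iff ht0).1 hy
    exact (hasDerivAt_loewnerMap hfl.cont ⟨ht0, hT⟩ him hlt.le hγ).differentiableAt
      |>.differentiableWithinAt
  · obtain ⟨T, hT, hfl⟩ := hflow t ht0 ht
    exact tendsto_loewnerMap_sub_self hfl.cont ⟨ht0, hT⟩
  · have hinv : ∀ y ∈ upperHalfPlaneSet,
        Function.invFunOn (f 0) upperHalfPlaneSet (f 0 y) = y := fun y hy =>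
      hinj.leftInvOn_invFunOn hy
    ext p
    constructor
    · rintro ⟨_, ⟨⟨y, hy, rfl⟩, hyK⟩, rfl⟩
      refine ⟨g t y, (hbij t ht0 ht).mapsTo ⟨hy, fun h => hyK ⟨y, ⟨h, hy⟩, rfl⟩⟩, ?_⟩
      simp only [hinv y hy]
    · rintro ⟨y', hy', rfl⟩
      obtain ⟨y, hy, rfl⟩ := (hbij t ht0 ht).surjOn hy'
      refine ⟨f 0 y, ⟨⟨y, hy.1, rfl⟩, ?_⟩, ?_⟩
      · rintro ⟨y₂, hy₂, he⟩
        exact hy.2 (hinj hy₂.2 hy.1 he ▸ hy₂.1)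
      · simp only [hinv y hy.1]
  · obtain ⟨T, hT, hfl⟩ := hflow t ht0 ht
    exact ⟨_, _, isPoissonKernel_domainPoisson hc (hf t ht0 ht),
      isComplexifiedDeriv_domainPoissonDeriv hc (hf t ht0 ht) (hfl.notMem_range ⟨ht0, hT.le⟩)⟩
  · obtain ⟨T₀, hT₀, hfl₀⟩ := hflow t ht0 ht
    have hζ : 0 < (φ q).im := hφ.2.2.1 hq
    obtain ⟨-, t', hlt, γ, hγ'⟩ := (mem_diff_loewnerHull_iff ht0).1 ⟨hφ.2.2.1 hq, hK⟩
    -- a common time up to which both the prevertices and the flow line of `φ q` exist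
    obtain ⟨T, htT, hTT₀, hTt'⟩ : ∃ T, t < T ∧ T ≤ T₀ ∧ T ≤ t' :=
      ⟨min T₀ t', lt_min hT₀ hlt, min_le_left _ _, min_le_right _ _⟩
    have hfl := hfl₀.mono hTT₀
    have hγ := hγ'.mono hTt'
    have htmem : t ∈ Icc 0 T := ⟨ht0, htT.le⟩
    have hg := isLoewnerSolution_loewnerMap hγ (ht0.trans htT.le) hfl.cont
    have hgim := hg.im_pos hfl.cont hζ htmem
    refine ⟨?_, fun k H hk hH => ?_⟩
    · rw [exp_logDerivPolygonFlow hc0 β w x hζ hgim]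
      refine (HasDerivAt.deriv ?_).symm
      exact (hf t ht0 ht _ hgim).comp q
        ((hasDerivAt_loewnerMap hfl.cont ⟨ht0, htT⟩ hζ htT.le hg).comp q
          (hφ.hasDerivAt hf0 hne0 hq))
    · have hspeed : ‖deriv (fun y : ℝ => f t y) (w t)‖ = scSpeed β (fun k => x k t) (w t) := by
        rw [(hasDerivAt_polygonMap_ofReal c β w (hfl.separated htmem)).deriv,
          norm_scIntegrand_ofReal hc]
      rw [hspeed, hH.eq_domainPoissonDeriv hc (hf t ht0 ht) (hfl.notMem_range htmem) hk hgim]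
      exact (hasDerivWithinAt_logDerivPolygonFlow β hfl hζ hγ htmem).mono_of_mem_nhdsWithin
        (by filter_upwards [self_mem_nhdsWithin, nhdsWithin_le_nhds (Iio_mem_nhds htT)]
              with s h1 h2 using ⟨h1, le_of_lt h2⟩)
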